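/- Let $I_{1,4}=\mathrm{diag}(1,-1,-1,-1,-1)$, $SO(1,4)=\{g\in SL(5,\mathbb R): g^tI_{1,4}g=I_{1,4}\}$, and let $G$ be $SO(1,4)$ or its identity component. Let $\mathfrak s$ be the space of symmetric matrices in $\mathfrak{so}(1,4)$, that is, the $(-1)$-eigenspace of the Cartan involution $X\mapsto -X^t$, and let $K=\{\mathrm{diag}(1,\beta):\beta\in SO(4)\}\cong SO(4)$. For a maximal abelian subalgebra $\mathfrak a\subset\mathfrak s$ with restricted root spaces $\mathfrak g_\alpha$, a Weyl chamber $\mathfrak a^+\subset\mathfrak a$ with set of simple roots $\Sigma$, and a proper subset $\Theta\subsetneq\Sigma$, put $\mathfrak p_\Theta=\mathfrak g_0+\sum_{\alpha>0}\mathfrak g_\alpha+\sum_{\alpha>0,\ \alpha\in\langle\Theta\rangle}\mathfrak g_{-\alpha}$, where $\langle\Theta\rangle$ is the linear span of $\Theta$, and let $P_\Theta=\{g\in G:\mathrm{Ad}(g)\mathfrak p_\Theta=\mathfrak p_\Theta\}$. The manifolds $G/P_\Theta$ are the flag manifolds of $G$. For $H\in\mathfrak a^+$ let $K_H=\{k\in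 K:\mathrm{Ad}(k)H=H\}$. Proposition (the sphere $S^3$ is the only flag manifold of $SO(1,4)$). (1) $\mathfrak{so}(1,4)$ has real rank one: every maximal abelian $\mathfrak a\subset\mathfrak s$ has dimension $1$. (2) $G$ has a single flag manifold, the maximal one: for each $\mathfrak a$ and $\mathfrak a^+$ the only proper subset $\Theta\subsetneq\Sigma$ is $\Theta=\emptyset$, and the groups $P=P_\emptyset$ obtained from different choices of $(\mathfrak a,\mathfrak a^+)$ are conjugate in $G$. (3) For $H_0=\begin{pmatrix}0&e_1\\e_1^t&0\end{pmatrix}$ with $e_1=(1,0,0,0)$, the line $\mathbb R H_0$ is maximal abelian in $\mathfrak s$, $H_0$ lies in a Weyl chamber of it, and $K_{H_0}=\{\mathrm{diag}(1,1,\gamma):\gamma\in SO(3)\}\cong SO(3)$. (4) For all $\mathfrak a$, $\mathfrak a^+$ and $H\in\mathfrak a^+$, with $P=P_\emptyset$: $K\subset G$, $K_H=K\cap P$, and $K_H$ is conjugate in $K$ to this $SO(3)$. There are diffeomorphisms $\varphi:G/P\to S^3$ and $\psi:K/K_H\to S^3$ onto the unit sphere $S^3\subset\mathbb R^4$ such that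 $\varphi(kP)=\psi(kK_H)$ for $k\in K$, and $\varphi(\mathrm{diag}(1,\beta)\cdot x)=\beta\,\varphi(x)$ for $\beta\in SO(4)$ and $x\in G/P$. Thus $G/P=K/K_H=SO(4)/SO(3)=S^3$. -/

import Mathlib

open scoped ContDiff Matrix Topology

noncomputable section

namespace LorentzFlag

attribute [local instance 100] LieRing.ofAssociativeRing

/-- The index set of `ℝ⁵ = ℝ¹ ⊕ ℝ⁴`. -/
abbrev Idx : Type := Fin 1 ⊕ Fin 4

/-- Real `5 × 5` matrices, in block form. -/
abbrev Mat : Type := Matrix Idx Idx ℝ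

/-- The ambient group `SL(5, ℝ)`, with its topology as a set of matrices. -/
abbrev SL5 : Type := Matrix.SpecialLinearGroup Idx ℝ

/-- `I_{1,4} = diag(1, -1, -1, -1, -1)`. -/
abbrev I14 : Mat := LieAlgebra.Orthogonal.indefiniteDiagonal (Fin 1) (Fin 4) ℝ

/-! ### The groups -/

/-- `SO(1,4)`: the matrices of determinant one that preserve the form `I_{1,4}`. -/
def SO14 : Subgroup SL5 where
  carrier := {g | (g : Mat)ᵀ * I14 * (g : Mat) = I14}
  one_mem' := by simp
  mul_mem' := by
    intro a b ha hb
    simp only [Set.mem_ofPred_eq] at ha hb ⊢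
    calc ((a * b : SL5) : Mat)ᵀ * I14 * ((a * b : SL5) : Mat)
        = (b : Mat)ᵀ * ((a : Mat)ᵀ * I14 * (a : Mat)) * (b : Mat) := by
          simp only [Matrix.SpecialLinearGroup.coe_mul, Matrix.transpose_mul, Matrix.mul_assoc]
      _ = I14 := by rw [ha, hb]
  inv_mem' := by
    intro a ha
    simp only [Set.mem_ofPred_eq] at ha ⊢
    have h1 : (a : Mat) * ((a⁻¹ : SL5) : Mat) = 1 := by
      rw [← Matrix.SpecialLinearGroup.coe_mul, mul_inv_cancel, Matrix.SpecialLinearGroup.coe_one]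
    have h2 : ((a⁻¹ : SL5) : Mat)ᵀ * (a : Mat)ᵀ = 1 := by
      rw [← Matrix.transpose_mul, h1, Matrix.transpose_one]
    calc ((a⁻¹ : SL5) : Mat)ᵀ * I14 * ((a⁻¹ : SL5) : Mat)
        = ((a⁻¹ : SL5) : Mat)ᵀ * ((a : Mat)ᵀ * I14 * (a : Mat)) * ((a⁻¹ : SL5) : Mat) := by
          rw [ha]
      _ = (((a⁻¹ : SL5) : Mat)ᵀ * (a : Mat)ᵀ) * I14 * ((a : Mat) * ((a⁻¹ : SL5) : Mat)) := by
          simp only [Matrix.mul_assoc]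
      _ = I14 := by rw [h1, h2, Matrix.one_mul, Matrix.mul_one]

/-- The identity component of `SO(1,4)`. -/
def SO14Conn : Subgroup SL5 := (Subgroup.connectedComponentOfOne SO14).map SO14.subtype

/-- The inclusion of `SO(4)` in `SL(5, ℝ)`, `β ↦ diag(1, β)`. -/
def embSO4 : Matrix.specialOrthogonalGroup (Fin 4) ℝ →* SL5 where
  toFun β := ⟨Matrix.fromBlocks 1 0 0 (β : Matrix (Fin 4) (Fin 4) ℝ), by
    rw [Matrix.det_fromBlocks_zero₂₁, Matrix.det_one, one_mul]
    exact (Matrix.mem_specialOrthogonalGroup_iff.1 β.2).2⟩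
  map_one' := by
    apply Subtype.ext
    simp
  map_mul' a b := by
    apply Subtype.ext
    change Matrix.fromBlocks 1 0 0 ((a : Matrix (Fin 4) (Fin 4) ℝ) * (b : Matrix (Fin 4) (Fin 4) ℝ))
      = Matrix.fromBlocks 1 0 0 (a : Matrix (Fin 4) (Fin 4) ℝ) *
        Matrix.fromBlocks 1 0 0 (b : Matrix (Fin 4) (Fin 4) ℝ)
    simp [Matrix.fromBlocks_multiply]

/-- The inclusion of `SO(3)` in `SO(4)`, `γ ↦ diag(1, γ)`. -/
def embSO3 : Matrix.specialOrthogonalGroup (Fin 3) ℝ →* Matrix.specialOrthogonalGroup (Fin 4) ℝ where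
  toFun γ := ⟨Matrix.reindex finSumFinEquiv finSumFinEquiv
      (Matrix.fromBlocks (1 : Matrix (Fin 1) (Fin 1) ℝ) 0 0 (γ : Matrix (Fin 3) (Fin 3) ℝ)), by
    have h := Matrix.mem_specialOrthogonalGroup_iff.1 γ.2
    refine Matrix.mem_specialOrthogonalGroup_iff.2 ⟨?_, ?_⟩
    · rw [Matrix.mem_orthogonalGroup_iff]
      have h1 := (Matrix.mem_orthogonalGroup_iff _ _).1 h.1
      simp only [Matrix.reindex_apply, Matrix.transpose_submatrix, Matrix.submatrix_mul_equiv,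
        Matrix.fromBlocks_transpose, Matrix.fromBlocks_multiply]
      simp [h1]
    · rw [Matrix.det_reindex_self, Matrix.det_fromBlocks_zero₂₁, Matrix.det_one, one_mul, h.2]⟩
  map_one' := by
    apply Subtype.ext
    simp
  map_mul' a b := by
    apply Subtype.ext
    simp [Matrix.fromBlocks_multiply, Matrix.submatrix_mul_equiv]

/-- The compact subgroup `K = SO(4)`, that is, the matrices `diag(1, β)`. -/
def K : Subgroup SL5 := embSO4.range

/-- The subgroup `SO(3)` of `K`, that is, the matrices `diag(1, 1, γ)`. -/
def SO3 : Subgroup SL5 := (embSO4.comp embSO3).range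

/-- The adjoint action `Ad(g) X = g X g⁻¹`. -/
def Ad (g : SL5) (X : Mat) : Mat := (g : Mat) * X * ((g⁻¹ : SL5) : Mat)

theorem Ad_one (X : Mat) : Ad 1 X = X := by simp [Ad]

theorem Ad_mul (g h : SL5) (X : Mat) : Ad (g * h) X = Ad g (Ad h X) := by
  simp only [Ad, mul_inv_rev, Matrix.SpecialLinearGroup.coe_mul, Matrix.mul_assoc]

/-- The stabilizer `K_H` of `H` in `K` under the adjoint action. -/
def KH (H : Mat) : Subgroup SL5 where
  carrier := {k | k ∈ K ∧ Ad k H = H}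
  one_mem' := ⟨K.one_mem, Ad_one H⟩
  mul_mem' := by
    rintro a b ⟨ha, ha'⟩ ⟨hb, hb'⟩
    exact ⟨K.mul_mem ha hb, by rw [Ad_mul, hb', ha']⟩
  inv_mem' := by
    rintro a ⟨ha, ha'⟩
    refine ⟨K.inv_mem ha, ?_⟩
    nth_rewrite 1 [← ha']
    rw [← Ad_mul, inv_mul_cancel, Ad_one]

/-! ### The Lie algebra, restricted roots and parabolic subalgebras -/

/-- The Lie algebra `so(1,4)`. -/
abbrev so14 : LieSubalgebra ℝ Mat := LieAlgebra.Orthogonal.so' (Fin 1) (Fin 4) ℝ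

/-- The symmetric component `𝔰` of the Cartan decomposition of `so(1,4)`: the eigenspace of the
Cartan involution `X ↦ -Xᵀ` for the eigenvalue `-1`. -/
def sComp : Submodule ℝ Mat where
  carrier := {X | X ∈ so14 ∧ -Xᵀ = -X}
  zero_mem' := ⟨so14.zero_mem, by simp⟩
  add_mem' := by
    rintro X Y ⟨hX, hX'⟩ ⟨hY, hY'⟩
    exact ⟨so14.add_mem hX hY, by rw [Matrix.transpose_add, neg_add, neg_add, hX', hY']⟩
  smul_mem' := by
    rintro c X ⟨hX, hX'⟩
    exact ⟨so14.smul_mem c hX, by rw [Matrix.transpose_smul, ← smul_neg, hX', smul_neg]⟩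

/-- `𝔞` is maximal among the abelian subalgebras contained in `𝔰`. -/
def IsMaxAbelian (a : Submodule ℝ Mat) : Prop :=
  Maximal (fun b : Submodule ℝ Mat => b ≤ sComp ∧ ∀ X ∈ b, ∀ Y ∈ b, ⁅X, Y⁆ = 0) a

/-- The space `𝔤_α = {X ∈ so(1,4) | [H, X] = α(H) X for all H ∈ 𝔞}`. -/
def rootSpace (a : Submodule ℝ Mat) (α : Module.Dual ℝ a) : Submodule ℝ Mat where
  carrier := {X | X ∈ so14 ∧ ∀ H : a, ⁅(H : Mat), X⁆ = α H • X}
  zero_mem' := ⟨so14.zero_mem, by simp⟩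
  add_mem' := by
    rintro X Y ⟨hX, hX'⟩ ⟨hY, hY'⟩
    exact ⟨so14.add_mem hX hY, fun H => by rw [lie_add, hX', hY', smul_add]⟩
  smul_mem' := by
    rintro c X ⟨hX, hX'⟩
    exact ⟨so14.smul_mem c hX, fun H => by rw [lie_smul, hX', smul_comm]⟩

/-- The restricted roots of `𝔞`. -/
def roots (a : Submodule ℝ Mat) : Set (Module.Dual ℝ a) :=
  {α | α ≠ 0 ∧ rootSpace a α ≠ ⊥}

/-- `H` is regular in `𝔞`: it lies in (exactly) one Weyl chamber, which is then called `𝔞⁺`. -/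
def IsRegular (a : Submodule ℝ Mat) (H : a) : Prop := ∀ α ∈ roots a, α H ≠ 0

/-- The positive roots for the Weyl chamber that contains the regular element `H`. -/
def posRoots (a : Submodule ℝ Mat) (H : a) : Set (Module.Dual ℝ a) :=
  {α | α ∈ roots a ∧ 0 < α H}

/-- The simple roots `Σ` for the Weyl chamber that contains the regular element `H`. -/
def simpleRoots (a : Submodule ℝ Mat) (H : a) : Set (Module.Dual ℝ a) :=
  {α | α ∈ posRoots a H ∧ ¬ ∃ β ∈ posRoots a H, ∃ γ ∈ posRoots a H, α = β + γ}

/-- The standard parabolic subalgebra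
`𝔭_Θ = 𝔤_0 + ∑_{α > 0} 𝔤_α + ∑_{α > 0, α ∈ ⟨Θ⟩} 𝔤_{-α}`. -/
def parabolicSubalgebra (a : Submodule ℝ Mat) (H : a) (Θ : Set (Module.Dual ℝ a)) :
    Submodule ℝ Mat :=
  rootSpace a 0 ⊔ (⨆ α ∈ posRoots a H, rootSpace a α) ⊔
    (⨆ α ∈ posRoots a H ∩ (Submodule.span ℝ Θ : Set (Module.Dual ℝ a)), rootSpace a (-α))

/-- The parabolic subgroup `P_Θ`, the normalizer of `𝔭_Θ` in `G`. -/
def parabolicSubgroup (G : Subgroup SL5) (a : Submodule ℝ Mat) (H : a)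
    (Θ : Set (Module.Dual ℝ a)) : Subgroup SL5 where
  carrier := {g | g ∈ G ∧
    ∀ X, X ∈ parabolicSubalgebra a H Θ ↔ Ad g X ∈ parabolicSubalgebra a H Θ}
  one_mem' := ⟨G.one_mem, fun X => by rw [Ad_one]⟩
  mul_mem' := by
    rintro g h ⟨hg, hg'⟩ ⟨hh, hh'⟩
    exact ⟨G.mul_mem hg hh, fun X => by rw [Ad_mul, ← hg', ← hh']⟩
  inv_mem' := by
    rintro g ⟨hg, hg'⟩
    exact ⟨G.inv_mem hg, fun X => by rw [hg' (Ad g⁻¹ X), ← Ad_mul, mul_inv_cancel, Ad_one]⟩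

/-! ### Homogeneous spaces, flag manifolds and the sphere -/

/-- The homogeneous space `G / P` (with the quotient topology and the action of `G`). -/
abbrev Homog (G P : Subgroup SL5) : Type := G ⧸ P.subgroupOf G

/-- The flag manifold `𝔽_Θ = G / P_Θ`. -/
abbrev FlagManifold (G : Subgroup SL5) (a : Submodule ℝ Mat) (H : a)
    (Θ : Set (Module.Dual ℝ a)) : Type :=
  Homog G (parabolicSubgroup G a H Θ)

/-- `(a, H, Θ)` are data that define a flag manifold (of positive dimension): `𝔞 ⊆ 𝔰` is maximal
abelian, `H` lies in a Weyl chamber `𝔞⁺` of `𝔞`, and `Θ` is a proper subset of the set of simple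
roots. -/
structure IsFlagData (a : Submodule ℝ Mat) (H : a) (Θ : Set (Module.Dual ℝ a)) : Prop where
  maxAbelian : IsMaxAbelian a
  regular : IsRegular a H
  ssubset : Θ ⊂ simpleRoots a H

section Smoothness

attribute [local instance] Matrix.normedAddCommGroup Matrix.normedSpace

/-- `ℝ⁴` with the Euclidean norm. -/
abbrev E4 : Type := EuclideanSpace ℝ (Fin 4)

/-- The sphere `S³`. -/
abbrev S3 : Type := Metric.sphere (0 : E4) 1

/-- A homeomorphism `φ : G / P ≃ₜ S³` (`P ≤ G` closed matrix groups) is a diffeomorphism.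

`G / P` carries the unique smooth structure for which `G → G / P` is a submersion. Hence `φ` is
smooth iff `g ↦ φ (g P)` is smooth on `G`, and `φ⁻¹` is smooth iff it lifts, near each point of the
sphere, to a smooth map into `G`. Here `G` and `S³` are embedded submanifolds of vector spaces, and
`ContDiffOn` on (a relatively open part of) them is smoothness in their manifold structure. -/
def IsDiffeoSphere {G P : Subgroup SL5} (φ : Homog G P ≃ₜ S3) : Prop :=
  (∃ F : Mat → E4, ContDiffOn ℝ ∞ F {A : Mat | ∃ g : G, ((g : SL5) : Mat) = A} ∧
    ∀ g : G, F ((g : SL5) : Mat) = (φ (QuotientGroup.mk g) : E4)) ∧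
  (∀ x : S3, ∃ U ∈ 𝓝 (x : E4), ∃ σ : E4 → Mat,
    ContDiffOn ℝ ∞ σ (U ∩ Metric.sphere 0 1) ∧
    ∀ y : S3, (y : E4) ∈ U →
      ∃ g : G, ((g : SL5) : Mat) = σ y ∧ φ (QuotientGroup.mk g) = y)

end Smoothness

/-- The matrix `H = [0 e₁; e₁ᵗ 0]` in `𝔰`. -/
def H0 : Mat :=
  Matrix.fromBlocks 0 (Matrix.of fun _ j => if j = 0 then 1 else 0)
    (Matrix.of fun i _ => if i = 0 then 1 else 0) 0

end LorentzFlag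

end

noncomputable section

namespace LorentzFlag

attribute [local instance 100] LieRing.ofAssociativeRing

/-! An element of `so(1,4)` is `blk p A` with `A` antisymmetric, and it lies in `𝔰` when `A = 0`.
The bracket of `blk u 0` with `blk p 0` has antisymmetric part `skew u p`, which vanishes only if
`p` is parallel to `u`. Hence the maximal abelian subspaces are the lines through `blk u 0` with `u`
a unit vector, and a Weyl chamber amounts to the choice of `u` against `-u`. The nonzero eigenvalues
of `ad (blk u 0)` are `1` and `-1`, so there is one positive root, it is simple, and `Θ = ∅`.

The geometric key is the null vector `pt u = (1, u)`. The algebra `𝔤_0 + 𝔤_α` consists of the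
elements of `so(1,4)` that have `pt u` as an eigenvector (`mem_parabolicSubalgebra`), and it
determines `u` (`eq_of_eigenvector`). So `P` is the stabilizer of `u` for the action `act` of `G` on
null lines, that is, on `S³` (`mem_parabolicSubgroup`). In the same way `K_H` is the stabilizer of
`u` in `K` (`mem_KH`), where `K` acts by rotations.

Unit quaternions provide a global smooth section of the orbit map with values in `K`, so
`exists_isDiffeoSphere` identifies both `G / P` and `K / K_H` with `S³` by orbit maps. For the
identity component, `K ≤ G` comes from the connectedness of `SO(4)`, proved with products of
reflections. -/

/-- The block matrix `[0 pᵗ; p A]`. -/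
def blk (p : Fin 4 → ℝ) (A : Matrix (Fin 4) (Fin 4) ℝ) : Mat :=
  Matrix.fromBlocks 0 (Matrix.of fun _ j => p j) (Matrix.of fun i _ => p i) A

/-- The point `(1, u)` of `ℝ⁵ = ℝ¹ ⊕ ℝ⁴`. -/
def pt (u : Fin 4 → ℝ) : Idx → ℝ := Sum.elim (fun _ => 1) u

theorem blk_mulVec_pt (p y : Fin 4 → ℝ) (A : Matrix (Fin 4) (Fin 4) ℝ) :
    blk p A *ᵥ pt y = Sum.elim (fun _ => p ⬝ᵥ y) (p + A *ᵥ y) := by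
  ext (i | i) <;> simp [blk, pt, Matrix.mulVec, dotProduct]

theorem blk_add (p q : Fin 4 → ℝ) (A B : Matrix (Fin 4) (Fin 4) ℝ) :
    blk p A + blk q B = blk (p + q) (A + B) := by
  ext (i | i) (j | j) <;> simp [blk]

theorem smul_blk (c : ℝ) (p : Fin 4 → ℝ) (A : Matrix (Fin 4) (Fin 4) ℝ) :
    c • blk p A = blk (c • p) (c • A) := by
  ext (i | i) (j | j) <;> simp [blk]

theorem blk_zero : blk 0 0 = 0 := by
  ext (i | i) (j | j) <;> simp [blk]

theorem blk_inj {p q : Fin 4 → ℝ} {A B : Matrix (Fin 4) (Fin 4) ℝ} :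
    blk p A = blk q B ↔ p = q ∧ A = B := by
  constructor
  · intro h
    constructor
    · ext i
      simpa [blk] using congrFun (congrFun h (.inr i)) (.inl 0)
    · ext i j
      simpa [blk] using congrFun (congrFun h (.inr i)) (.inr j)
  · rintro ⟨rfl, rfl⟩
    rfl

/-! ### The algebra `so(1,4)`, the subspace `𝔰` and brackets in block form. -/

theorem mem_so14_iff_transpose {X : Mat} : X ∈ so14 ↔ Xᵀ * I14 = I14 * -X := by
  rw [so14, LieAlgebra.Orthogonal.so', mem_skewAdjointMatricesLieSubalgebra,
    mem_skewAdjointMatricesSubmodule]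
  rfl

theorem mem_so14 {X : Mat} :
    X ∈ so14 ↔ ∃ (p : Fin 4 → ℝ) (A : Matrix (Fin 4) (Fin 4) ℝ), Aᵀ = -A ∧ X = blk p A := by
  rw [mem_so14_iff_transpose, ← Matrix.ext_iff]
  simp only [I14, LieAlgebra.Orthogonal.indefiniteDiagonal, Matrix.mul_diagonal,
    Matrix.diagonal_mul, Matrix.transpose_apply, Matrix.neg_apply]
  constructor
  · intro h
    refine ⟨fun i => X (.inr i) (.inl 0), X.toBlocks₂₂, ?_, ?_⟩
    · ext i j
      have := h (.inr i) (.inr j)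
      simp at this
      simp [Matrix.toBlocks₂₂]
      linarith
    · ext (i | i) (j | j)
      · have := h (.inl i) (.inl j)
        fin_cases i; fin_cases j
        simp at this
        simp [blk]
        linarith
      · have := h (.inl i) (.inr j)
        fin_cases i
        simp at this
        simp [blk]
        linarith
      · fin_cases j
        simp [blk]
      · simp [blk, Matrix.toBlocks₂₂]
  · rintro ⟨p, A, hA, rfl⟩ (i | i) (j | j)
    · simp [blk]
    · simp [blk]
    · simp [blk]
    · have := congrFun (congrFun hA i) j
      simp at this
      simp [blk, this]

theorem blk_mem_so14 {p : Fin 4 → ℝ} {A : Matrix (Fin 4) (Fin 4) ℝ} (hA : Aᵀ = -A) :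
    blk p A ∈ so14 := mem_so14.2 ⟨p, A, hA, rfl⟩

theorem mem_sComp {X : Mat} : X ∈ sComp ↔ ∃ p, X = blk p 0 := by
  change X ∈ so14 ∧ -Xᵀ = -X ↔ _
  constructor
  · rintro ⟨h, h'⟩
    obtain ⟨p, A, hA, rfl⟩ := mem_so14.1 h
    refine ⟨p, blk_inj.2 ⟨rfl, ?_⟩⟩
    ext i j
    have h1 := congrFun (congrFun h' (.inr i)) (.inr j)
    have h2 := congrFun (congrFun hA i) j
    simp [blk] at h1 h2
    simp
    linarith
  · rintro ⟨p, rfl⟩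
    refine ⟨blk_mem_so14 (by simp), ?_⟩
    ext (i | i) (j | j) <;> simp [blk]

theorem H0_eq_blk : H0 = blk (Pi.single 0 1) 0 := by
  ext (i | i) (j | j) <;> simp [H0, blk, Pi.single_apply]

/-- The antisymmetric matrix `u qᵗ - q uᵗ`. -/
def skew (u q : Fin 4 → ℝ) : Matrix (Fin 4) (Fin 4) ℝ :=
  Matrix.vecMulVec u q - Matrix.vecMulVec q u

theorem skew_transpose (u q : Fin 4 → ℝ) : (skew u q)ᵀ = -skew u q := by
  ext i j
  simp [skew, Matrix.vecMulVec_apply, mul_comm]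

theorem skew_mulVec (u q y : Fin 4 → ℝ) :
    skew u q *ᵥ y = (q ⬝ᵥ y) • u - (u ⬝ᵥ y) • q := by
  ext i
  simp [skew, Matrix.sub_mulVec, Matrix.vecMulVec_mulVec, mul_comm]

theorem lie_blk (v p : Fin 4 → ℝ) {A : Matrix (Fin 4) (Fin 4) ℝ} (hA : Aᵀ = -A) :
    ⁅blk v 0, blk p A⁆ = blk (-(A *ᵥ v)) (skew v p) := by
  have h (i j) : A i j = - A j i := by simpa using congrFun (congrFun hA j) i
  rw [LieRing.of_associative_ring_bracket]
  ext (i | i) (j | j)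
  · simp [blk, Matrix.mul_apply, mul_comm]
  · simp [blk, Matrix.mul_apply, Matrix.mulVec, dotProduct, h _ j, mul_comm]
  · simp [blk, Matrix.mul_apply, Matrix.mulVec, dotProduct]
  · simp [blk, skew, Matrix.mul_apply, Matrix.vecMulVec_apply]

/-! ### Maximal abelian subspaces -/

/-- Evaluating `skew u p` at `u` gives `(p ⬝ᵥ u) • u - p`. -/
theorem eq_smul_of_skew_eq_zero {u p : Fin 4 → ℝ} (hu : u ⬝ᵥ u = 1) (h : skew u p = 0) :
    p = (p ⬝ᵥ u) • u := by
  have := skew_mulVec u p u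
  rw [h, hu, Matrix.zero_mulVec, one_smul] at this
  exact (sub_eq_zero.1 this.symm).symm

theorem exists_unit {p : Fin 4 → ℝ} (hp : p ≠ 0) :
    ∃ (r : ℝ) (u : Fin 4 → ℝ), 0 < r ∧ u ⬝ᵥ u = 1 ∧ p = r • u := by
  have h : 0 < p ⬝ᵥ p := lt_of_le_of_ne
    (by simpa using dotProduct_star_self_nonneg p) (fun h => hp (dotProduct_self_eq_zero.1 h.symm))
  have hs := Real.sqrt_pos.2 h
  refine ⟨√(p ⬝ᵥ p), (√(p ⬝ᵥ p))⁻¹ • p, hs, ?_, by rw [smul_inv_smul₀ hs.ne']⟩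
  rw [smul_dotProduct, dotProduct_smul, smul_eq_mul, smul_eq_mul]
  field_simp
  exact (Real.sq_sqrt h.le).symm

theorem isMaxAbelian_span {u : Fin 4 → ℝ} (hu : u ⬝ᵥ u = 1) :
    IsMaxAbelian (Submodule.span ℝ {blk u 0}) := by
  constructor
  · constructor
    · rw [Submodule.span_singleton_le_iff_mem]
      exact mem_sComp.2 ⟨u, rfl⟩
    · intro X hX Y hY
      obtain ⟨c, rfl⟩ := Submodule.mem_span_singleton.1 hX
      obtain ⟨d, rfl⟩ := Submodule.mem_span_singleton.1 hY
      rw [smul_lie, lie_smul, lie_self, smul_zero, smul_zero]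
  · rintro b ⟨hb, hb'⟩ hle X hX
    obtain ⟨p, rfl⟩ := mem_sComp.1 (hb hX)
    have h := hb' _ (hle (Submodule.mem_span_singleton_self _)) _ hX
    rw [lie_blk u p (by simp), ← blk_zero] at h
    rw [eq_smul_of_skew_eq_zero hu (blk_inj.1 h).2, Submodule.mem_span_singleton]
    exact ⟨p ⬝ᵥ u, by rw [smul_blk, smul_zero]⟩

theorem IsMaxAbelian.eq_span {a : Submodule ℝ Mat} (ha : IsMaxAbelian a) {r : ℝ} (hr : r ≠ 0)
    {u : Fin 4 → ℝ} (hu : u ⬝ᵥ u = 1) (h : r • blk u 0 ∈ a) :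
    a = Submodule.span ℝ {blk u 0} := by
  have h' : blk u 0 ∈ a := by simpa [smul_smul, hr] using a.smul_mem r⁻¹ h
  refine ((isMaxAbelian_span hu).eq_of_le ha.prop ?_).symm
  rwa [Submodule.span_singleton_le_iff_mem]

theorem IsMaxAbelian.exists_of_ne_zero {a : Submodule ℝ Mat} (ha : IsMaxAbelian a) {X : Mat}
    (hX : X ∈ a) (h0 : X ≠ 0) :
    ∃ (r : ℝ) (u : Fin 4 → ℝ), 0 < r ∧ u ⬝ᵥ u = 1 ∧ X = r • blk u 0 ∧
      a = Submodule.span ℝ {blk u 0} := by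
  obtain ⟨p, rfl⟩ := mem_sComp.1 (ha.prop.1 hX)
  have hp : p ≠ 0 := by
    rintro rfl
    exact h0 blk_zero
  obtain ⟨r, u, hr, hu, rfl⟩ := exists_unit hp
  have h : blk (r • u) 0 = r • blk u 0 := by rw [smul_blk, smul_zero]
  exact ⟨r, u, hr, hu, h, ha.eq_span hr.ne' hu (h ▸ hX)⟩

theorem single_dotProduct_self : (Pi.single 0 1 : Fin 4 → ℝ) ⬝ᵥ Pi.single 0 1 = 1 := by simp

theorem blk_ne_zero {u : Fin 4 → ℝ} (hu : u ⬝ᵥ u = 1) (A) : blk u A ≠ 0 := by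
  rw [← blk_zero, Ne, blk_inj]
  rintro ⟨rfl, -⟩
  simp at hu

theorem IsMaxAbelian.exists_unit {a : Submodule ℝ Mat} (ha : IsMaxAbelian a) :
    ∃ u : Fin 4 → ℝ, u ⬝ᵥ u = 1 ∧ a = Submodule.span ℝ {blk u 0} := by
  have hne : a ≠ ⊥ := by
    rintro rfl
    -- The zero subspace is abelian but not maximal, since lines are abelian too.
    have h := ha.eq_of_le (isMaxAbelian_span single_dotProduct_self).prop bot_le
    have := Submodule.mem_span_singleton_self (R := ℝ) (blk (Pi.single 0 1) 0)
    rw [← h, Submodule.mem_bot] at this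
    exact blk_ne_zero single_dotProduct_self _ this
  obtain ⟨X, hX, h0⟩ := Submodule.exists_mem_ne_zero_of_ne_bot hne
  obtain ⟨_, u, _, hu, _, h⟩ := ha.exists_of_ne_zero hX h0
  exact ⟨u, hu, h⟩

theorem IsMaxAbelian.finrank_eq_one {a : Submodule ℝ Mat} (ha : IsMaxAbelian a) :
    Module.finrank ℝ a = 1 := by
  obtain ⟨u, hu, rfl⟩ := ha.exists_unit
  exact finrank_span_singleton (blk_ne_zero hu 0)

/-! ### Restricted roots -/

/-- The generator of the line spanned by `[0 uᵗ; u 0]`. -/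
def gen (u : Fin 4 → ℝ) : Submodule.span ℝ {blk u 0} :=
  ⟨blk u 0, Submodule.mem_span_singleton_self _⟩

theorem exists_smul_gen {u : Fin 4 → ℝ} (X : Submodule.span ℝ {blk u 0}) :
    ∃ c : ℝ, X = c • gen u := by
  obtain ⟨c, hc⟩ := Submodule.mem_span_singleton.1 X.2
  exact ⟨c, Subtype.ext hc.symm⟩

theorem dual_ext {u : Fin 4 → ℝ} {α β : Module.Dual ℝ (Submodule.span ℝ {blk u 0})}
    (h : α (gen u) = β (gen u)) : α = β := by
  ext X
  obtain ⟨c, rfl⟩ := exists_smul_gen X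
  simp [h]

theorem exists_dual {u : Fin 4 → ℝ} (hu : u ⬝ᵥ u = 1) (c : ℝ) :
    ∃ α : Module.Dual ℝ (Submodule.span ℝ {blk u 0}), α (gen u) = c := by
  have h0 : gen u ≠ 0 := fun h => blk_ne_zero hu 0 (congrArg Subtype.val h)
  obtain ⟨f, h⟩ := not_forall.1 (mt (Module.forall_dual_apply_eq_zero_iff ℝ (gen u)).1 h0)
  exact ⟨(c / f (gen u)) • f, by simp [h]⟩

theorem mem_rootSpace {u : Fin 4 → ℝ} (α : Module.Dual ℝ (Submodule.span ℝ {blk u 0})) {X : Mat} :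
    X ∈ rootSpace _ α ↔ ∃ (p : Fin 4 → ℝ) (A : Matrix (Fin 4) (Fin 4) ℝ), Aᵀ = -A ∧
      X = blk p A ∧ -(A *ᵥ u) = α (gen u) • p ∧ skew u p = α (gen u) • A := by
  change X ∈ so14 ∧ (∀ H : Submodule.span ℝ {blk u 0}, ⁅(H : Mat), X⁆ = α H • X) ↔ _
  constructor
  · rintro ⟨h, h'⟩
    obtain ⟨p, A, hA, rfl⟩ := mem_so14.1 h
    have := h' (gen u)
    rw [gen, lie_blk _ _ hA, smul_blk, blk_inj] at this
    exact ⟨p, A, hA, rfl, this⟩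
  · rintro ⟨p, A, hA, rfl, h1, h2⟩
    refine ⟨blk_mem_so14 hA, fun H => ?_⟩
    obtain ⟨c, rfl⟩ := exists_smul_gen H
    rw [map_smul, Submodule.coe_smul, smul_lie, smul_assoc]
    congr 1
    rw [gen, lie_blk _ _ hA, smul_blk, blk_inj]
    exact ⟨h1, h2⟩

theorem exists_orthogonal {u : Fin 4 → ℝ} (hu : u ⬝ᵥ u = 1) :
    ∃ q : Fin 4 → ℝ, q ⬝ᵥ q = 1 ∧ q ⬝ᵥ u = 0 := by
  -- The product of the quaternions `i` and `u`.
  refine ⟨![-u 1, u 0, -u 3, u 2], ?_, ?_⟩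
  · simp [dotProduct, Fin.sum_univ_four] at hu ⊢
    linarith
  · simp [dotProduct, Fin.sum_univ_four]
    ring

theorem blk_mem_rootSpace {u q : Fin 4 → ℝ} (hu : u ⬝ᵥ u = 1) (hq : q ⬝ᵥ u = 0)
    {α : Module.Dual ℝ (Submodule.span ℝ {blk u 0})} (hα : α (gen u) * α (gen u) = 1) :
    blk q (α (gen u) • skew u q) ∈ rootSpace _ α := by
  refine (mem_rootSpace α).2 ⟨q, _, ?_, rfl, ?_, ?_⟩
  · rw [Matrix.transpose_smul, skew_transpose, smul_neg]
  · rw [Matrix.smul_mulVec, skew_mulVec, hq, hu]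
    simp
  · rw [smul_smul, hα, one_smul]

/-- With `c = α (gen u)`, the equation `skew u p = c A` determines `A`. Substituted in `-A u = c p`,
it gives `c² p = p - (p ⬝ᵥ u) u`, and the product with `u` shows that `p` is orthogonal to `u`. -/
theorem mem_rootSpace_of_ne_zero {u : Fin 4 → ℝ} (hu : u ⬝ᵥ u = 1)
    {α : Module.Dual ℝ (Submodule.span ℝ {blk u 0})} (h0 : α (gen u) ≠ 0) {X : Mat}
    (hX : X ∈ rootSpace _ α) :
    ∃ q : Fin 4 → ℝ, X = blk q ((α (gen u))⁻¹ • skew u q) ∧ q ⬝ᵥ u = 0 ∧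
      (α (gen u) * α (gen u)) • q = q := by
  obtain ⟨p, A, hA, rfl, h1, h2⟩ := (mem_rootSpace α).1 hX
  have h3 : A = (α (gen u))⁻¹ • skew u p := by rw [h2, smul_smul, inv_mul_cancel₀ h0, one_smul]
  have h4 : (α (gen u) * α (gen u)) • p = p - (p ⬝ᵥ u) • u := by
    rw [mul_smul, ← h1, smul_neg, ← Matrix.smul_mulVec, ← h2, skew_mulVec, hu]
    simp
  have h5 : p ⬝ᵥ u = 0 := by
    have h6 := congrArg (· ⬝ᵥ u) h4
    simp only [smul_dotProduct, sub_dotProduct, hu, smul_eq_mul, mul_one, sub_self] at h6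
    simpa [h0] using h6
  exact ⟨p, by rw [← h3], h5, by simpa [h5] using h4⟩

theorem mem_roots {u : Fin 4 → ℝ} (hu : u ⬝ᵥ u = 1)
    (α : Module.Dual ℝ (Submodule.span ℝ {blk u 0})) :
    α ∈ roots _ ↔ α (gen u) * α (gen u) = 1 := by
  constructor
  · rintro ⟨h1, h2⟩
    have h0 : α (gen u) ≠ 0 := fun h => h1 (dual_ext (by simpa using h))
    obtain ⟨X, hX, hX0⟩ := Submodule.exists_mem_ne_zero_of_ne_bot h2
    obtain ⟨q, rfl, -, hq⟩ := mem_rootSpace_of_ne_zero hu h0 hX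
    by_contra hne
    have : (α (gen u) * α (gen u) - 1) • q = 0 := by rw [sub_smul, hq, one_smul, sub_self]
    rcases smul_eq_zero.1 this with h | rfl
    · exact hne (sub_eq_zero.1 h)
    · apply hX0
      simp [skew, blk_zero]
  · intro h
    constructor
    · rintro rfl
      simp at h
    · obtain ⟨q, hq, hqu⟩ := exists_orthogonal hu
      intro hbot
      have := blk_mem_rootSpace hu hqu h
      rw [hbot, Submodule.mem_bot] at this
      exact blk_ne_zero hq _ this

theorem mem_posRoots {u : Fin 4 → ℝ} (hu : u ⬝ᵥ u = 1) {r : ℝ} (hr : 0 < r)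
    (α : Module.Dual ℝ (Submodule.span ℝ {blk u 0})) :
    α ∈ posRoots _ (r • gen u) ↔ α (gen u) = 1 := by
  change α ∈ roots _ ∧ _ ↔ _
  rw [mem_roots hu, map_smul, smul_eq_mul, mul_pos_iff_of_pos_left hr, mul_self_eq_one_iff]
  constructor
  · rintro ⟨h | h, h'⟩
    · exact h
    · linarith
  · intro h
    exact ⟨.inl h, by simp [h]⟩

theorem mem_simpleRoots {u : Fin 4 → ℝ} (hu : u ⬝ᵥ u = 1) {r : ℝ} (hr : 0 < r)
    (α : Module.Dual ℝ (Submodule.span ℝ {blk u 0})) :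
    α ∈ simpleRoots _ (r • gen u) ↔ α (gen u) = 1 := by
  change α ∈ posRoots _ _ ∧ _ ↔ _
  rw [mem_posRoots hu hr, and_iff_left_iff_imp]
  -- A sum of two positive roots takes the value `2` at `gen u`, so it is not a positive root.
  rintro h ⟨β, hβ, γ, hγ, rfl⟩
  rw [mem_posRoots hu hr] at hβ hγ
  rw [LinearMap.add_apply, hβ, hγ] at h
  norm_num at h

theorem isRegular_smul_gen {u : Fin 4 → ℝ} (hu : u ⬝ᵥ u = 1) {r : ℝ} (hr : r ≠ 0) :
    IsRegular _ (r • gen u) := by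
  intro α hα h
  rw [map_smul, smul_eq_mul, mul_eq_zero, or_iff_right hr] at h
  rw [mem_roots hu, h] at hα
  norm_num at hα

theorem isRegular_H0 :
    IsRegular (Submodule.span ℝ {H0}) ⟨H0, Submodule.mem_span_singleton_self H0⟩ := by
  -- The subspace in the type depends on `H0`, so the matrix is generalized before the substitution.
  have h (X : Mat) (hX : X = blk (Pi.single 0 1) 0) :
      IsRegular (Submodule.span ℝ {X}) ⟨X, Submodule.mem_span_singleton_self X⟩ := by
    subst hX
    have := isRegular_smul_gen single_dotProduct_self one_ne_zero
    rwa [one_smul] at this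
  exact h H0 H0_eq_blk

/-- A regular `H` is nonzero because roots exist. Taking `r > 0` puts the sign of `H` into `u`, so
that `u` encodes the chamber. -/
theorem IsRegular.exists_eq {a : Submodule ℝ Mat} {H : a} (hH : IsRegular a H)
    (ha : IsMaxAbelian a) :
    ∃ (r : ℝ) (u : Fin 4 → ℝ), 0 < r ∧ u ⬝ᵥ u = 1 ∧ (H : Mat) = r • blk u 0 ∧
      a = Submodule.span ℝ {blk u 0} := by
  refine ha.exists_of_ne_zero H.2 fun h0 => ?_
  obtain ⟨u, hu, rfl⟩ := ha.exists_unit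
  obtain ⟨α, hα⟩ := exists_dual hu 1
  refine hH α ((mem_roots hu α).2 (by simp [hα])) ?_
  rw [show H = 0 from Subtype.ext h0, map_zero]

theorem ssubset_simpleRoots_iff {u : Fin 4 → ℝ} (hu : u ⬝ᵥ u = 1) {r : ℝ} (hr : 0 < r)
    (Θ : Set (Module.Dual ℝ (Submodule.span ℝ {blk u 0}))) :
    Θ ⊂ simpleRoots _ (r • gen u) ↔ Θ = ∅ := by
  obtain ⟨α, hα⟩ := exists_dual hu 1
  have : simpleRoots _ (r • gen u) = {α} := by
    ext β
    rw [mem_simpleRoots hu hr, Set.mem_singleton_iff]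
    exact ⟨fun h => dual_ext (h.trans hα.symm), fun h => h ▸ hα⟩
  rw [this, Set.ssubset_singleton_iff]

/-! ### The parabolic subalgebra and its normalizer -/

/-- The vector `pt u` is an eigenvector of `blk p A` exactly when `p + A u = (p ⬝ᵥ u) u`. Elements
of `𝔤_0` satisfy this because `A u = 0` and `p` is parallel to `u`; those of `𝔤_α` because they are
`blk q (skew u q)` with `q` orthogonal to `u`. -/
theorem mem_parabolicSubalgebra {u : Fin 4 → ℝ} (hu : u ⬝ᵥ u = 1) {r : ℝ} (hr : 0 < r) {X : Mat} :
    X ∈ parabolicSubalgebra _ (r • gen u) ∅ ↔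
      X ∈ so14 ∧ ∃ c : ℝ, X *ᵥ pt u = c • pt u := by
  obtain ⟨α, hα⟩ := exists_dual hu 1
  have hpos : posRoots _ (r • gen u) = {α} := by
    ext β
    rw [mem_posRoots hu hr, Set.mem_singleton_iff]
    exact ⟨fun h => dual_ext (h.trans hα.symm), fun h => h ▸ hα⟩
  have hdisj : ({α} : Set _) ∩
      (Submodule.span ℝ (∅ : Set (Module.Dual ℝ (Submodule.span ℝ {blk u 0}))) : Set _) = ∅ := by
    ext β
    simp only [Submodule.span_empty, Set.mem_inter_iff, Set.mem_singleton_iff, SetLike.mem_coe,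
      Submodule.mem_bot, Set.mem_empty_iff_false, iff_false, not_and]
    rintro rfl rfl
    simp at hα
  rw [parabolicSubalgebra, hpos, hdisj]
  simp only [Set.mem_singleton_iff, iSup_iSup_eq_left, Set.mem_empty_iff_false, iSup_false,
    iSup_bot, sup_bot_eq]
  rw [Submodule.mem_sup]
  have hpt (p : Fin 4 → ℝ) (A : Matrix (Fin 4) (Fin 4) ℝ) (c : ℝ) :
      blk p A *ᵥ pt u = c • pt u ↔ p ⬝ᵥ u = c ∧ p + A *ᵥ u = c • u := by
    rw [blk_mulVec_pt]
    constructor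
    · intro h
      constructor
      · simpa [pt] using congrFun h (.inl 0)
      · ext i
        simpa [pt] using congrFun h (.inr i)
    · rintro ⟨h1, h2⟩
      ext (i | i)
      · simp [pt, h1]
      · simp [pt, h2]
  constructor
  · rintro ⟨Y, hY, Z, hZ, rfl⟩
    refine ⟨so14.add_mem hY.1 hZ.1, ?_⟩
    obtain ⟨p, A, hA, rfl, h1, h2⟩ := (mem_rootSpace _).1 hY
    obtain ⟨q, rfl, h3, h4⟩ := mem_rootSpace_of_ne_zero hu (by simp [hα]) hZ
    refine ⟨p ⬝ᵥ u, ?_⟩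
    simp only [LinearMap.zero_apply, zero_smul, neg_eq_zero] at h1 h2
    rw [hα, inv_one, one_smul, blk_add, hpt, Matrix.add_mulVec, h1, skew_mulVec, h3, hu,
      add_dotProduct, h3]
    refine ⟨by simp, ?_⟩
    rw [← eq_smul_of_skew_eq_zero hu h2]
    simp
  · rintro ⟨hX, c, hc⟩
    obtain ⟨p, A, hA, rfl⟩ := mem_so14.1 hX
    obtain ⟨rfl, h⟩ := (hpt _ _ _).1 hc
    -- The part of `p` orthogonal to `u` gives the component in `𝔤_α`; what remains commutes with
    -- `blk u 0`.
    set q := p - (p ⬝ᵥ u) • u with hq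
    have hqu : q ⬝ᵥ u = 0 := by
      rw [hq, sub_dotProduct, smul_dotProduct, hu, smul_eq_mul, mul_one, sub_self]
    refine ⟨blk ((p ⬝ᵥ u) • u) (A - skew u q), ?_, blk q (skew u q), ?_, ?_⟩
    · refine (mem_rootSpace _).2 ⟨_, _, ?_, rfl, ?_, ?_⟩
      · rw [Matrix.transpose_sub, skew_transpose, hA]
        abel
      · rw [Matrix.sub_mulVec, skew_mulVec, hqu, hu, LinearMap.zero_apply, zero_smul, zero_smul,
          one_smul, hq, ← h]
        abel
      · rw [LinearMap.zero_apply, zero_smul, skew]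
        ext i j
        simp [Matrix.vecMulVec_apply]
    · simpa [hα] using blk_mem_rootSpace hu hqu (α := α) (by simp [hα])
    · rw [blk_add, hq]
      congr 1 <;> abel

/-! ### The action on the sphere of null lines -/

/-- The action of `SO(1,4)` on the sphere, identified with the set of null lines: the line of
`(1, u)` goes to the line of `(1, act g u)`. -/
def act (g : SL5) (u : Fin 4 → ℝ) : Fin 4 → ℝ :=
  fun i => ((g : Mat) *ᵥ pt u) (.inr i) / ((g : Mat) *ᵥ pt u) (.inl 0)

theorem pt_inl (u : Fin 4 → ℝ) (i : Fin 1) : pt u (.inl i) = 1 := rfl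

theorem pt_inr (u : Fin 4 → ℝ) (i : Fin 4) : pt u (.inr i) = u i := rfl

theorem act_eq_of_mulVec {g : SL5} {u y : Fin 4 → ℝ} {c : ℝ} (hc : c ≠ 0)
    (h : (g : Mat) *ᵥ pt u = c • pt y) : act g u = y := by
  ext i
  rw [act, h, Pi.smul_apply, Pi.smul_apply, pt_inl, pt_inr, smul_eq_mul, smul_eq_mul, mul_one,
    mul_div_cancel_left₀ _ hc]

theorem pt_ne_zero (u : Fin 4 → ℝ) : pt u ≠ 0 := fun h => by
  simpa [pt] using congrFun h (.inl 0)

theorem dotProduct_I14_mulVec (x : Idx → ℝ) :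
    x ⬝ᵥ (I14 *ᵥ x) = x (.inl 0) * x (.inl 0) - (x ∘ Sum.inr) ⬝ᵥ (x ∘ Sum.inr) := by
  simp [I14, LieAlgebra.Orthogonal.indefiniteDiagonal, Matrix.mulVec_diagonal, dotProduct,
    sub_eq_add_neg]

theorem mulVec_inv_mulVec (g : SL5) (x : Idx → ℝ) :
    ((g⁻¹ : SL5) : Mat) *ᵥ ((g : Mat) *ᵥ x) = x := by
  rw [Matrix.mulVec_mulVec, ← Matrix.SpecialLinearGroup.coe_mul, inv_mul_cancel,
    Matrix.SpecialLinearGroup.coe_one, Matrix.one_mulVec]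

theorem mulVec_ne_zero (g : SL5) {x : Idx → ℝ} (hx : x ≠ 0) : (g : Mat) *ᵥ x ≠ 0 := fun h =>
  hx (by rw [← mulVec_inv_mulVec g x, h, Matrix.mulVec_zero])

theorem null_mulVec {g : SL5} (hg : g ∈ SO14) {u : Fin 4 → ℝ} (hu : u ⬝ᵥ u = 1) :
    ((g : Mat) *ᵥ pt u) ⬝ᵥ (I14 *ᵥ ((g : Mat) *ᵥ pt u)) = 0 := by
  have hg' : (g : Mat)ᵀ * I14 * (g : Mat) = I14 := hg
  rw [← Matrix.vecMul_transpose, Matrix.vecMul_transpose, Matrix.mulVec_mulVec,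
    ← Matrix.vecMul_transpose, ← Matrix.dotProduct_mulVec, Matrix.mulVec_mulVec,
    ← Matrix.mul_assoc, hg', dotProduct_I14_mulVec]
  simp [pt, Function.comp_def, hu]

/-- A null vector whose first coordinate vanishes is zero, and `g` is invertible. So the division in
`act` is legitimate on unit vectors. -/
theorem mulVec_pt_inl_ne_zero {g : SL5} (hg : g ∈ SO14) {u : Fin 4 → ℝ} (hu : u ⬝ᵥ u = 1) :
    ((g : Mat) *ᵥ pt u) (.inl 0) ≠ 0 := by
  intro h0
  have h := null_mulVec hg hu
  rw [dotProduct_I14_mulVec, h0, mul_zero, zero_sub, neg_eq_zero, dotProduct_self_eq_zero] at h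
  refine mulVec_ne_zero g (pt_ne_zero u) ?_
  ext (i | i)
  · rw [Subsingleton.elim i 0, h0, Pi.zero_apply]
  · exact congrFun h i

theorem mulVec_pt {g : SL5} (hg : g ∈ SO14) {u : Fin 4 → ℝ} (hu : u ⬝ᵥ u = 1) :
    (g : Mat) *ᵥ pt u = ((g : Mat) *ᵥ pt u) (.inl 0) • pt (act g u) := by
  have h0 := mulVec_pt_inl_ne_zero hg hu
  ext (i | i)
  · rw [Subsingleton.elim i 0, Pi.smul_apply, pt_inl, smul_eq_mul, mul_one]
  · rw [Pi.smul_apply, smul_eq_mul, pt_inr, act, mul_div_cancel₀ _ h0]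

theorem act_unit {g : SL5} (hg : g ∈ SO14) {u : Fin 4 → ℝ} (hu : u ⬝ᵥ u = 1) :
    act g u ⬝ᵥ act g u = 1 := by
  have h0 := mulVec_pt_inl_ne_zero hg hu
  have h := null_mulVec hg hu
  rw [mulVec_pt hg hu, dotProduct_I14_mulVec] at h
  set c := ((g : Mat) *ᵥ pt u) (.inl 0)
  have h1 : ((c • pt (act g u)) ∘ Sum.inr) = c • act g u := by
    ext i
    simp [pt]
  have h2 : (c • pt (act g u)) (.inl 0) = c := by simp [pt]
  rw [h1, h2, smul_dotProduct, dotProduct_smul, smul_eq_mul, smul_eq_mul] at h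
  have h3 : c * c * (1 - act g u ⬝ᵥ act g u) = 0 := by linarith
  have := (mul_eq_zero.1 h3).resolve_left (mul_ne_zero h0 h0)
  linarith

theorem act_mul {g h : SL5} (hg : g ∈ SO14) (hh : h ∈ SO14) {u : Fin 4 → ℝ} (hu : u ⬝ᵥ u = 1) :
    act (g * h) u = act g (act h u) := by
  refine act_eq_of_mulVec (mul_ne_zero (mulVec_pt_inl_ne_zero hh hu)
    (mulVec_pt_inl_ne_zero hg (act_unit hh hu))) ?_
  rw [mul_smul, ← mulVec_pt hg (act_unit hh hu), ← Matrix.mulVec_smul, ← mulVec_pt hh hu,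
    Matrix.SpecialLinearGroup.coe_mul, Matrix.mulVec_mulVec]

theorem act_one (u : Fin 4 → ℝ) : act 1 u = u :=
  act_eq_of_mulVec one_ne_zero (by simp)

theorem act_inv_eq {g : SL5} (hg : g ∈ SO14) {u y : Fin 4 → ℝ} (hu : u ⬝ᵥ u = 1)
    (h : act g u = y) : act g⁻¹ y = u := by
  rw [← h, ← act_mul (inv_mem hg) hg hu, inv_mul_cancel, act_one]

theorem coe_embSO4 (β : Matrix.specialOrthogonalGroup (Fin 4) ℝ) :
    ((embSO4 β : SL5) : Mat) =
      Matrix.fromBlocks 1 0 0 (β : Matrix (Fin 4) (Fin 4) ℝ) := rfl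

theorem transpose_mul_self (β : Matrix.specialOrthogonalGroup (Fin 4) ℝ) :
    (β : Matrix (Fin 4) (Fin 4) ℝ)ᵀ * (β : Matrix (Fin 4) (Fin 4) ℝ) = 1 :=
  (Matrix.mem_orthogonalGroup_iff' _ _).1 (Matrix.mem_specialOrthogonalGroup_iff.1 β.2).1

theorem act_embSO4 (β : Matrix.specialOrthogonalGroup (Fin 4) ℝ) (u : Fin 4 → ℝ) :
    act (embSO4 β) u = (β : Matrix (Fin 4) (Fin 4) ℝ) *ᵥ u := by
  refine act_eq_of_mulVec one_ne_zero ?_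
  rw [coe_embSO4, pt, Matrix.fromBlocks_mulVec]
  ext (i | i) <;> simp [pt, Function.comp_def]

theorem I14_eq_fromBlocks : I14 = Matrix.fromBlocks 1 0 0 (-1) := by
  ext (i | i) (j | j) <;>
    simp [I14, LieAlgebra.Orthogonal.indefiniteDiagonal, Matrix.diagonal_apply, Matrix.one_apply]
  split_ifs <;> simp

theorem K_le_SO14 : K ≤ SO14 := by
  rintro _ ⟨β, rfl⟩
  change ((embSO4 β : SL5) : Mat)ᵀ * I14 * ((embSO4 β : SL5) : Mat) = I14
  rw [coe_embSO4, I14_eq_fromBlocks]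
  simp [Matrix.fromBlocks_transpose, Matrix.fromBlocks_multiply, transpose_mul_self]

/-! ### Quaternions and the transitivity of `SO(4)` on the sphere -/

/-- The matrix of the left multiplication by a quaternion. -/
def quat (y : Fin 4 → ℝ) : Matrix (Fin 4) (Fin 4) ℝ :=
  !![y 0, -y 1, -y 2, -y 3; y 1, y 0, -y 3, y 2; y 2, y 3, y 0, -y 1; y 3, -y 2, y 1, y 0]

theorem quat_mem {y : Fin 4 → ℝ} (hy : y ⬝ᵥ y = 1) :
    quat y ∈ Matrix.specialOrthogonalGroup (Fin 4) ℝ := by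
  simp only [dotProduct, Fin.sum_univ_four] at hy
  rw [Matrix.mem_specialOrthogonalGroup_iff, Matrix.mem_orthogonalGroup_iff]
  constructor
  · ext i j
    fin_cases i <;> fin_cases j <;>
      simp [quat, Matrix.mul_apply, Fin.sum_univ_four] <;> linarith
  -- The determinant is the square of the quaternion norm `y ⬝ᵥ y`.
  · have : (quat y).det = (y 0 * y 0 + y 1 * y 1 + y 2 * y 2 + y 3 * y 3) ^ 2 := by
      simp [quat, Matrix.det_succ_row_zero, Fin.sum_univ_succ, Fin.succAbove]
      ring
    rw [this, hy, one_pow]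

/-- The left multiplication by a unit quaternion, as a rotation. -/
def quatRot (y : Fin 4 → ℝ) (hy : y ⬝ᵥ y = 1) : Matrix.specialOrthogonalGroup (Fin 4) ℝ :=
  ⟨quat y, quat_mem hy⟩

theorem quat_mulVec_single (y : Fin 4 → ℝ) : quat y *ᵥ Pi.single 0 1 = y := by
  ext i
  fin_cases i <;> simp [quat]

theorem quat_transpose_mulVec {y : Fin 4 → ℝ} (hy : y ⬝ᵥ y = 1) :
    (quat y)ᵀ *ᵥ y = Pi.single 0 1 := by
  have h : (quat y)ᵀ * quat y = 1 := transpose_mul_self (quatRot y hy)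
  calc (quat y)ᵀ *ᵥ y = (quat y)ᵀ *ᵥ (quat y *ᵥ Pi.single 0 1) := by rw [quat_mulVec_single]
    _ = Pi.single 0 1 := by rw [Matrix.mulVec_mulVec, h, Matrix.one_mulVec]

/-- A rotation that takes the unit vector `u` to the unit vector `y`. -/
def rot {u y : Fin 4 → ℝ} (hu : u ⬝ᵥ u = 1) (hy : y ⬝ᵥ y = 1) :
    Matrix.specialOrthogonalGroup (Fin 4) ℝ :=
  quatRot y hy * (quatRot u hu)⁻¹

theorem coe_rot {u y : Fin 4 → ℝ} (hu : u ⬝ᵥ u = 1) (hy : y ⬝ᵥ y = 1) :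
    (rot hu hy : Matrix (Fin 4) (Fin 4) ℝ) = quat y * (quat u)ᵀ := rfl

theorem rot_mulVec {u y : Fin 4 → ℝ} (hu : u ⬝ᵥ u = 1) (hy : y ⬝ᵥ y = 1) :
    (rot hu hy : Matrix (Fin 4) (Fin 4) ℝ) *ᵥ u = y := by
  rw [coe_rot, ← Matrix.mulVec_mulVec, quat_transpose_mulVec hu, quat_mulVec_single]

theorem act_rot {u y : Fin 4 → ℝ} (hu : u ⬝ᵥ u = 1) (hy : y ⬝ᵥ y = 1) :
    act (embSO4 (rot hu hy)) u = y := by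
  rw [act_embSO4, rot_mulVec]

theorem embSO4_mem_K (β : Matrix.specialOrthogonalGroup (Fin 4) ℝ) : embSO4 β ∈ K := ⟨β, rfl⟩

/-! ### Stabilizers -/

theorem Ad_mem_so14 {g : SL5} (hg : g ∈ SO14) {X : Mat} (hX : X ∈ so14) : Ad g X ∈ so14 := by
  rw [mem_so14_iff_transpose] at hX ⊢
  have hg' : (g : Mat)ᵀ * I14 * (g : Mat) = I14 := hg
  have hgi : (g : Mat) * ((g⁻¹ : SL5) : Mat) = 1 := by
    rw [← Matrix.SpecialLinearGroup.coe_mul, mul_inv_cancel, Matrix.SpecialLinearGroup.coe_one]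
  have hig : ((g⁻¹ : SL5) : Mat)ᵀ * (g : Mat)ᵀ = 1 := by
    rw [← Matrix.transpose_mul, hgi, Matrix.transpose_one]
  have h1 : (g : Mat)ᵀ * I14 = I14 * ((g⁻¹ : SL5) : Mat) := by
    rw [← hg', Matrix.mul_assoc _ (g : Mat), hgi, Matrix.mul_one, hg']
  have h2 : ((g⁻¹ : SL5) : Mat)ᵀ * I14 = I14 * (g : Mat) := by
    conv_lhs => rw [← hg']
    rw [← Matrix.mul_assoc, ← Matrix.mul_assoc, hig, Matrix.one_mul]
  calc (Ad g X)ᵀ * I14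
      = ((g⁻¹ : SL5) : Mat)ᵀ * Xᵀ * ((g : Mat)ᵀ * I14) := by
        simp only [Ad, Matrix.transpose_mul, Matrix.mul_assoc]
    _ = ((g⁻¹ : SL5) : Mat)ᵀ * (Xᵀ * I14) * ((g⁻¹ : SL5) : Mat) := by
        rw [h1]
        simp only [Matrix.mul_assoc]
    _ = (((g⁻¹ : SL5) : Mat)ᵀ * I14) * -X * ((g⁻¹ : SL5) : Mat) := by
        rw [hX]
        simp only [Matrix.mul_assoc]
    _ = I14 * -Ad g X := by
        rw [h2, Ad]
        simp only [Matrix.mul_assoc, Matrix.mul_neg, Matrix.neg_mul]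

/-- The test matrices `blk p (skew u p)` all have `pt u` as an eigenvector. The choice `p = u`
forces `y = u` or `y = -u`; a unit vector `p` orthogonal to `u` rules out `-u`. -/
theorem eq_of_eigenvector {u y : Fin 4 → ℝ} (hu : u ⬝ᵥ u = 1)
    (h : ∀ X ∈ so14, (∃ c : ℝ, X *ᵥ pt u = c • pt u) → ∃ c : ℝ, X *ᵥ pt y = c • pt y) :
    y = u := by
  have hX (p : Fin 4 → ℝ) :
      ∃ c : ℝ, p ⬝ᵥ y = c ∧ p + ((p ⬝ᵥ y) • u - (u ⬝ᵥ y) • p) = c • y := by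
    obtain ⟨c, hc⟩ := h (blk p (skew u p)) (blk_mem_so14 (skew_transpose u p)) ⟨p ⬝ᵥ u, by
      rw [blk_mulVec_pt, skew_mulVec, hu, one_smul, add_sub_cancel]
      ext (i | i) <;> simp [pt]⟩
    rw [blk_mulVec_pt, skew_mulVec] at hc
    refine ⟨c, by simpa [pt] using congrFun hc (.inl 0), ?_⟩
    ext i
    simpa [pt] using congrFun hc (.inr i)
  obtain ⟨q, hq, hqu⟩ := exists_orthogonal hu
  obtain ⟨_, rfl, h1⟩ := hX u
  have h2 : u = (u ⬝ᵥ y) • y := by simpa using h1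
  have h3 : (u ⬝ᵥ y) * (u ⬝ᵥ y) = 1 := by
    have := congrArg (u ⬝ᵥ ·) h2
    simpa only [dotProduct_smul, smul_eq_mul, hu] using this.symm
  rcases mul_self_eq_one_iff.1 h3 with h4 | h4
  · rw [h4, one_smul] at h2
    exact h2.symm
  · rw [h4, neg_one_smul] at h2
    subst h2
    obtain ⟨_, rfl, h5⟩ := hX q
    have h6 : q ⬝ᵥ y = 0 := by simpa using hqu
    rw [h6, h4] at h5
    simp at h5
    have h7 : q = 0 := by
      ext i
      have := congrFun h5 i
      simp at this
      simpa using this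
    simp [h7] at hq

theorem act_eq_self_iff {g : SL5} (hg : g ∈ SO14) {u : Fin 4 → ℝ} (hu : u ⬝ᵥ u = 1) :
    act g u = u ↔ ∃ c : ℝ, c ≠ 0 ∧ (g : Mat) *ᵥ pt u = c • pt u := by
  constructor
  · intro h
    have := mulVec_pt hg hu
    rw [h] at this
    exact ⟨_, mulVec_pt_inl_ne_zero hg hu, this⟩
  · rintro ⟨c, hc, h⟩
    exact act_eq_of_mulVec hc h

theorem Ad_mulVec (g : SL5) (X : Mat) (x : Idx → ℝ) :
    Ad g X *ᵥ ((g : Mat) *ᵥ x) = (g : Mat) *ᵥ (X *ᵥ x) := by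
  rw [Ad, ← Matrix.mulVec_mulVec, mulVec_inv_mulVec, Matrix.mulVec_mulVec]

theorem mem_parabolicSubgroup {G : Subgroup SL5} (hG : G ≤ SO14) {u : Fin 4 → ℝ}
    (hu : u ⬝ᵥ u = 1) {r : ℝ} (hr : 0 < r) {g : SL5} :
    g ∈ parabolicSubgroup G _ (r • gen u) ∅ ↔ g ∈ G ∧ act g u = u := by
  change (g ∈ G ∧ ∀ X, _ ↔ _) ↔ _
  simp only [mem_parabolicSubalgebra hu hr]
  refine and_congr_right fun hgG => ?_
  have hg := hG hgG
  constructor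
  · intro h
    -- If `Y` lies in the parabolic subalgebra, so does `Ad g⁻¹ Y`; transporting its eigenvector `pt
    -- u` by `g` makes `pt (act g u)` an eigenvector of `Y`.
    refine eq_of_eigenvector hu fun Y hY hYu => ?_
    have hY' : Ad g (Ad g⁻¹ Y) = Y := by rw [← Ad_mul, mul_inv_cancel, Ad_one]
    obtain ⟨-, c, hc⟩ := (h (Ad g⁻¹ Y)).2 (by rw [hY']; exact ⟨hY, hYu⟩)
    refine ⟨c, ?_⟩
    have h1 := Ad_mulVec g (Ad g⁻¹ Y) (pt u)
    rw [hY', hc, Matrix.mulVec_smul, mulVec_pt hg hu, Matrix.mulVec_smul, smul_comm] at h1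
    exact smul_right_injective _ (mulVec_pt_inl_ne_zero hg hu) h1
  · intro h
    have key {k : SL5} (hk : k ∈ SO14) (hku : act k u = u) {X : Mat}
        (hX : X ∈ so14 ∧ ∃ c : ℝ, X *ᵥ pt u = c • pt u) :
        Ad k X ∈ so14 ∧ ∃ c : ℝ, Ad k X *ᵥ pt u = c • pt u := by
      refine ⟨Ad_mem_so14 hk hX.1, ?_⟩
      obtain ⟨c, hc⟩ := hX.2
      obtain ⟨d, hd, hkd⟩ := (act_eq_self_iff hk hu).1 hku
      refine ⟨c, smul_right_injective _ hd ?_⟩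
      change d • _ = d • _
      rw [← Matrix.mulVec_smul, ← hkd, Ad_mulVec, hc, Matrix.mulVec_smul, hkd, smul_comm]
    refine fun X => ⟨key hg h, fun hX => ?_⟩
    have := key (inv_mem hg) (act_inv_eq hg hu h) hX
    rwa [← Ad_mul, inv_mul_cancel, Ad_one] at this

theorem Ad_eq_iff (g : SL5) (X Y : Mat) : Ad g X = Y ↔ (g : Mat) * X = Y * (g : Mat) := by
  have h1 : ((g⁻¹ : SL5) : Mat) * (g : Mat) = 1 := by
    rw [← Matrix.SpecialLinearGroup.coe_mul, inv_mul_cancel, Matrix.SpecialLinearGroup.coe_one]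
  have h2 : (g : Mat) * ((g⁻¹ : SL5) : Mat) = 1 := by
    rw [← Matrix.SpecialLinearGroup.coe_mul, mul_inv_cancel, Matrix.SpecialLinearGroup.coe_one]
  constructor
  · rintro rfl
    rw [Ad, Matrix.mul_assoc _ _ (g : Mat), h1, Matrix.mul_one]
  · intro h
    rw [Ad, h, Matrix.mul_assoc, h2, Matrix.mul_one]

/-- For `k = diag(1, β)`, commuting with `blk u 0` means `β u = u` and `uᵗ β = uᵗ`; these are
equivalent because `β` is orthogonal. -/
theorem mem_KH {u : Fin 4 → ℝ} {r : ℝ} (hr : r ≠ 0) {g : SL5} :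
    g ∈ KH (r • blk u 0) ↔ g ∈ K ∧ act g u = u := by
  change (g ∈ K ∧ Ad g _ = _) ↔ _
  refine and_congr_right ?_
  rintro ⟨β, rfl⟩
  rw [act_embSO4, Ad_eq_iff, Matrix.mul_smul, Matrix.smul_mul,
    (smul_right_injective Mat hr).eq_iff, coe_embSO4, blk, Matrix.fromBlocks_multiply,
    Matrix.fromBlocks_multiply]
  simp only [Matrix.one_mul, Matrix.zero_mul, Matrix.mul_zero, Matrix.mul_one, add_zero, zero_add,
    Matrix.fromBlocks_inj, true_and, and_true]
  constructor
  · rintro ⟨-, h⟩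
    ext i
    simpa [Matrix.mul_apply, Matrix.mulVec, dotProduct] using congrFun (congrFun h i) 0
  · intro h
    refine ⟨?_, ?_⟩
    · have h' : (β : Matrix (Fin 4) (Fin 4) ℝ)ᵀ *ᵥ u = u := by
        conv_lhs => rw [← h]
        rw [Matrix.mulVec_mulVec, transpose_mul_self, Matrix.one_mulVec]
      ext i j
      have := congrFun h' j
      simpa [Matrix.mul_apply, Matrix.mulVec, dotProduct, mul_comm] using this.symm
    · ext i j
      simpa [Matrix.mul_apply, Matrix.mulVec, dotProduct] using congrFun h i

theorem coe_embSO3 (γ : Matrix.specialOrthogonalGroup (Fin 3) ℝ) :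
    (embSO3 γ : Matrix (Fin 4) (Fin 4) ℝ) =
      Matrix.reindex finSumFinEquiv finSumFinEquiv
        (Matrix.fromBlocks (1 : Matrix (Fin 1) (Fin 1) ℝ) 0 0
          (γ : Matrix (Fin 3) (Fin 3) ℝ)) := rfl

theorem finSumFinEquiv_one_inl : finSumFinEquiv (m := 1) (n := 3) (.inl 0) = 0 := rfl

theorem finSumFinEquiv_one_inr (i : Fin 3) :
    finSumFinEquiv (m := 1) (n := 3) (.inr i) = i.succ := by
  fin_cases i <;> rfl

theorem embSO3_mulVec_single (γ : Matrix.specialOrthogonalGroup (Fin 3) ℝ) :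
    (embSO3 γ : Matrix (Fin 4) (Fin 4) ℝ) *ᵥ Pi.single 0 1 = Pi.single 0 1 := by
  have h0 : (finSumFinEquiv (m := 1) (n := 3)).symm 0 = .inl 0 := rfl
  rw [coe_embSO3]
  ext i
  obtain ⟨i, rfl⟩ := (finSumFinEquiv (m := 1) (n := 3)).surjective i
  rcases i with i | i
  · fin_cases i
    simp [h0, finSumFinEquiv_one_inl]
  · simp [h0]
    rw [finSumFinEquiv_one_inr, Pi.single_eq_of_ne (Fin.succ_ne_zero i)]

theorem exists_embSO3_eq {β : Matrix.specialOrthogonalGroup (Fin 4) ℝ}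
    (h : (β : Matrix (Fin 4) (Fin 4) ℝ) *ᵥ Pi.single 0 1 = Pi.single 0 1) :
    ∃ γ, embSO3 γ = β := by
  set M : Matrix (Fin 1 ⊕ Fin 3) (Fin 1 ⊕ Fin 3) ℝ :=
    Matrix.reindex finSumFinEquiv.symm finSumFinEquiv.symm
      (β : Matrix (Fin 4) (Fin 4) ℝ) with hM
  -- By orthogonality the transpose also fixes `e₁`, so the first row, like the first column, is
  -- that of the identity.
  have h' : (β : Matrix (Fin 4) (Fin 4) ℝ)ᵀ *ᵥ Pi.single 0 1 = Pi.single 0 1 := by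
    conv_lhs => rw [← h]
    rw [Matrix.mulVec_mulVec, transpose_mul_self, Matrix.one_mulVec]
  have hcol (i) : (β : Matrix (Fin 4) (Fin 4) ℝ) i 0 = (Pi.single 0 1 : Fin 4 → ℝ) i := by
    simpa using congrFun h i
  have hrow (i) : (β : Matrix (Fin 4) (Fin 4) ℝ) 0 i = (Pi.single 0 1 : Fin 4 → ℝ) i := by
    simpa using congrFun h' i
  have hblock : M = Matrix.fromBlocks 1 0 0 M.toBlocks₂₂ := by
    ext (i | i) (j | j)
    · fin_cases i; fin_cases j
      simp [hM, hcol, finSumFinEquiv_one_inl]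
    · fin_cases i
      simp [hM, hrow, finSumFinEquiv_one_inl, finSumFinEquiv_one_inr]
    · fin_cases j
      simp [hM, hcol, finSumFinEquiv_one_inl, finSumFinEquiv_one_inr]
    · rfl
  have hMT : Mᵀ * M = 1 := by
    rw [hM, Matrix.reindex_apply, Matrix.transpose_submatrix, Matrix.submatrix_mul_equiv]
    exact (congrArg (Matrix.submatrix · _ _) (transpose_mul_self β)).trans
      (Matrix.submatrix_one_equiv _)
  have hdet : M.det = 1 := by
    rw [hM, Matrix.det_reindex_self]
    exact (Matrix.mem_specialOrthogonalGroup_iff.1 β.2).2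
  have hmem : M.toBlocks₂₂ ∈ Matrix.specialOrthogonalGroup (Fin 3) ℝ := by
    rw [Matrix.mem_specialOrthogonalGroup_iff, Matrix.mem_orthogonalGroup_iff']
    constructor
    · rw [hblock, Matrix.fromBlocks_transpose, Matrix.fromBlocks_multiply, ← Matrix.fromBlocks_one,
        Matrix.fromBlocks_inj] at hMT
      simpa using hMT.2.2.2
    · rw [hblock, Matrix.det_fromBlocks_zero₂₁, Matrix.det_one, one_mul] at hdet
      exact hdet
  refine ⟨⟨_, hmem⟩, Subtype.ext ?_⟩
  rw [coe_embSO3]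
  change Matrix.reindex _ _ (Matrix.fromBlocks 1 0 0 M.toBlocks₂₂) = _
  rw [← hblock, hM]
  ext i j
  simp

theorem mem_SO3 {g : SL5} : g ∈ SO3 ↔ g ∈ K ∧ act g (Pi.single 0 1) = Pi.single 0 1 := by
  constructor
  · rintro ⟨γ, rfl⟩
    refine ⟨embSO4_mem_K _, ?_⟩
    rw [MonoidHom.comp_apply, act_embSO4, embSO3_mulVec_single]
  · rintro ⟨⟨β, rfl⟩, h⟩
    rw [act_embSO4] at h
    obtain ⟨γ, rfl⟩ := exists_embSO3_eq h
    exact ⟨γ, rfl⟩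

theorem KH_H0 : KH H0 = SO3 := by
  ext g
  rw [H0_eq_blk, ← one_smul ℝ (blk _ _), mem_KH one_ne_zero, mem_SO3]

/-- Stabilizers of two points of an orbit are conjugate. -/
theorem eq_map_conj {G P Q : Subgroup SL5} (hG : G ≤ SO14) {u y : Fin 4 → ℝ} (hu : u ⬝ᵥ u = 1)
    (hP : ∀ g, g ∈ P ↔ g ∈ G ∧ act g u = u) (hQ : ∀ g, g ∈ Q ↔ g ∈ G ∧ act g y = y)
    {k : SL5} (hk : k ∈ G) (hku : act k u = y) :
    Q = P.map (MulAut.conj k).toMonoidHom := by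
  have hki := act_inv_eq (hG hk) hu hku
  have hy : y ⬝ᵥ y = 1 := hku ▸ act_unit (hG hk) hu
  ext g
  rw [Subgroup.mem_map, hQ]
  constructor
  · rintro ⟨hg, hgy⟩
    refine ⟨k⁻¹ * g * k, (hP _).2 ⟨mul_mem (mul_mem (inv_mem hk) hg) hk, ?_⟩, ?_⟩
    · rw [act_mul (hG (mul_mem (inv_mem hk) hg)) (hG hk) hu, hku,
        act_mul (hG (inv_mem hk)) (hG hg) hy, hgy, hki]
    · simp [mul_assoc]
  · rintro ⟨p, hp, rfl⟩
    obtain ⟨hpG, hpu⟩ := (hP p).1 hp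
    refine ⟨mul_mem (mul_mem hk hpG) (inv_mem hk), ?_⟩
    change act (k * p * k⁻¹) y = y
    rw [act_mul (hG (mul_mem hk hpG)) (hG (inv_mem hk)) hy, hki, act_mul (hG hk) (hG hpG) hu, hpu,
      hku]

/-! ### Homogeneous spaces over the sphere -/

theorem mem_sphere_iff {x : E4} : x ∈ Metric.sphere (0 : E4) 1 ↔ x.ofLp ⬝ᵥ x.ofLp = 1 := by
  rw [mem_sphere_zero_iff_norm, ← sq_eq_sq₀ (norm_nonneg _) zero_le_one, one_pow,
    EuclideanSpace.real_norm_sq_eq]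
  simp [dotProduct, sq]

section Smoothness

attribute [local instance] Matrix.normedAddCommGroup Matrix.normedSpace

/-- The section `y ↦ diag(1, y ū)` of the projection to the sphere (a quaternion product). -/
def sphereSection (u : Fin 4 → ℝ) (y : E4) : Mat :=
  Matrix.fromBlocks 1 0 0 (quat y.ofLp * (quat u)ᵀ)

theorem contDiff_matrix {E : Type*} [NormedAddCommGroup E] [NormedSpace ℝ E] {m n : Type*}
    [Fintype m] [Fintype n] {f : E → Matrix m n ℝ}
    (h : ∀ i j, ContDiff ℝ ∞ fun x => f x i j) : ContDiff ℝ ∞ f :=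
  contDiff_pi.2 fun i => contDiff_pi.2 fun j => h i j

theorem contDiff_sphereSection (u : Fin 4 → ℝ) : ContDiff ℝ ∞ (sphereSection u) := by
  have hq (i j) : ContDiff ℝ ∞ fun y : E4 => quat y.ofLp i j := by
    fin_cases i <;> fin_cases j <;> simp [quat] <;> fun_prop
  refine contDiff_matrix ?_
  rintro (i | i) (j | j)
  · exact contDiff_const
  · exact contDiff_const
  · exact contDiff_const
  · simp only [sphereSection, Matrix.fromBlocks_apply₂₂, Matrix.mul_apply]
    exact ContDiff.sum fun k _ => (hq i k).mul contDiff_const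

theorem contDiff_entry (i j : Idx) : ContDiff ℝ ∞ fun A : Mat => A i j :=
  (contDiff_apply_apply (𝕜 := ℝ) (E := ℝ) i j)

theorem contDiffOn_act (u : Fin 4 → ℝ) :
    ContDiffOn ℝ ∞ (fun A : Mat => (WithLp.toLp 2 fun i =>
      (A *ᵥ pt u) (.inr i) / (A *ᵥ pt u) (.inl 0) : E4))
      {A : Mat | (A *ᵥ pt u) (.inl 0) ≠ 0} := by
  have h (i : Idx) : ContDiff ℝ ∞ fun A : Mat => (A *ᵥ pt u) i := by
    simp only [Matrix.mulVec, dotProduct]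
    exact ContDiff.sum fun k _ => (contDiff_entry i k).mul contDiff_const
  rw [contDiffOn_euclidean]
  exact fun i => (h _).contDiffOn.div (h _).contDiffOn fun A hA => hA

/-- The orbit map `g ↦ act g u` has fibres the cosets of `Q` and is rational in the entries of `g`.
Its inverse is the projection of the section by rotations, which `K ≤ G` makes available. This
serves both for `(G, P)` and for `(K, K_H)`. -/
theorem exists_isDiffeoSphere {G Q : Subgroup SL5} (hK : K ≤ G) (hG : G ≤ SO14)
    {u : Fin 4 → ℝ} (hu : u ⬝ᵥ u = 1) (hQ : ∀ g, g ∈ Q ↔ g ∈ G ∧ act g u = u) :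
    ∃ φ : Homog G Q ≃ₜ S3, IsDiffeoSphere φ ∧
      ∀ g : G, (φ (QuotientGroup.mk g) : E4) = WithLp.toLp 2 (act g u) := by
  have hne (g : G) := mulVec_pt_inl_ne_zero (hG g.2) hu
  let f (g : G) : S3 := ⟨WithLp.toLp 2 (act g u), mem_sphere_iff.2 (act_unit (hG g.2) hu)⟩
  have hf : Continuous f := by
    refine Continuous.subtype_mk ?_ _
    have hg : Continuous fun g : G => ((g : SL5) : Mat) :=
      continuous_subtype_val.comp continuous_subtype_val
    exact (contDiffOn_act u).continuousOn.comp_continuous hg hne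
  have hfQ (g h : G) : QuotientGroup.leftRel (Q.subgroupOf G) g h ↔ f g = f h := by
    rw [QuotientGroup.leftRel_apply, Subgroup.mem_subgroupOf, hQ]
    have h1 : f g = f h ↔ act g u = act h u := by
      simp only [f, Subtype.mk.injEq, WithLp.toLp.injEq]
    rw [h1, Subgroup.coe_mul, Subgroup.coe_inv, act_mul (inv_mem (hG g.2)) (hG h.2) hu]
    constructor
    · rintro ⟨-, h2⟩
      have := congrArg (act g) h2
      rw [← act_mul (hG g.2) (inv_mem (hG g.2)) (act_unit (hG h.2) hu), mul_inv_cancel,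
        act_one] at this
      exact this.symm
    · intro h2
      exact ⟨mul_mem (inv_mem g.2) h.2, by rw [← h2, ← act_mul (inv_mem (hG g.2)) (hG g.2) hu,
        inv_mul_cancel, act_one]⟩
  let s (x : S3) : G := ⟨embSO4 (rot hu (mem_sphere_iff.1 x.2)), hK (embSO4_mem_K _)⟩
  have hs_coe (x : S3) : ((s x : SL5) : Mat) = sphereSection u (x : E4) := rfl
  have hs : Continuous s := by
    refine Continuous.subtype_mk (Continuous.subtype_mk ?_ _) _
    exact (contDiff_sphereSection u).continuous.comp continuous_subtype_val
  have hfs (x : S3) : f (s x) = x := by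
    apply Subtype.ext
    change WithLp.toLp 2 (act (embSO4 (rot hu _)) u) = (x : E4)
    rw [act_rot]
  let F : Homog G Q → S3 := Quotient.lift f fun g h => (hfQ g h).1
  let φ : Homog G Q ≃ₜ S3 :=
    { toFun := F
      invFun := fun x => QuotientGroup.mk (s x)
      left_inv := by
        intro x
        induction x using QuotientGroup.induction_on with
        | H g => exact Quotient.sound ((hfQ _ _).2 (hfs (f g)))
      right_inv := hfs
      continuous_toFun := hf.quotient_lift _
      continuous_invFun := QuotientGroup.continuous_mk.comp hs }
  refine ⟨φ, ⟨⟨_, (contDiffOn_act u).mono ?_, fun g => rfl⟩, fun x => ?_⟩, fun g => rfl⟩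
  · rintro _ ⟨g, rfl⟩
    exact hne g
  -- The section is global, so one neighbourhood works at every point.
  · exact ⟨Set.univ, Filter.univ_mem, sphereSection u, (contDiff_sphereSection u).contDiffOn,
      fun y _ => ⟨s y, hs_coe y, hfs y⟩⟩

end Smoothness

/-! ### Connectedness of `SO(4)` -/

/-- The reflection in the hyperplane orthogonal to the unit vector `v`. -/
def refl (v : Fin 4 → ℝ) : Matrix (Fin 4) (Fin 4) ℝ := 1 - (2 : ℝ) • Matrix.vecMulVec v v

theorem refl_mulVec (v x : Fin 4 → ℝ) : refl v *ᵥ x = x - (2 * (v ⬝ᵥ x)) • v := by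
  ext i
  simp [refl, Matrix.sub_mulVec, Matrix.smul_mulVec, Matrix.vecMulVec_mulVec]
  ring

theorem refl_transpose (v : Fin 4 → ℝ) : (refl v)ᵀ = refl v := by
  ext i j
  simp [refl, Matrix.vecMulVec_apply, Matrix.one_apply, mul_comm, eq_comm]

theorem refl_mul_self {v : Fin 4 → ℝ} (hv : v ⬝ᵥ v = 1) : refl v * refl v = 1 := by
  refine Matrix.ext_of_mulVec_single fun j => ?_
  rw [← Matrix.mulVec_mulVec, Matrix.one_mulVec, refl_mulVec, refl_mulVec, dotProduct_sub,
    dotProduct_smul, hv, smul_eq_mul, mul_one]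
  ext i
  simp
  ring

theorem det_refl {v : Fin 4 → ℝ} (hv : v ⬝ᵥ v = 1) : (refl v).det = -1 := by
  -- The matrix determinant lemma `det (1 + a bᵗ) = 1 + b ⬝ᵥ a` with `a = -2v` and `b = v`.
  have h := Matrix.det_one_add_replicateCol_mul_replicateRow (ι := Unit) (-(2 : ℝ) • v) v
  rw [dotProduct_smul, hv] at h
  rw [refl, sub_eq_add_neg, ← neg_smul, ← Matrix.smul_vecMulVec, Matrix.vecMulVec_eq Unit, h]
  norm_num

theorem refl_mul_refl_mem {w v : Fin 4 → ℝ} (hw : w ⬝ᵥ w = 1) (hv : v ⬝ᵥ v = 1) :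
    refl w * refl v ∈ Matrix.specialOrthogonalGroup (Fin 4) ℝ := by
  rw [Matrix.mem_specialOrthogonalGroup_iff, Matrix.mem_orthogonalGroup_iff]
  constructor
  · rw [Matrix.transpose_mul, refl_transpose, refl_transpose, Matrix.mul_assoc,
      ← Matrix.mul_assoc (refl v), refl_mul_self hv, Matrix.one_mul, refl_mul_self hw]
  · rw [Matrix.det_mul, det_refl hw, det_refl hv]
    norm_num

/-- The rotations that lie in the identity component of `SO(1,4)`, as a set of matrices. -/
def connRot : Set (Matrix (Fin 4) (Fin 4) ℝ) :=
  {M | ∃ β : Matrix.specialOrthogonalGroup (Fin 4) ℝ,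
    (β : Matrix (Fin 4) (Fin 4) ℝ) = M ∧ embSO4 β ∈ SO14Conn}

theorem mul_mem_connRot {M N : Matrix (Fin 4) (Fin 4) ℝ} (hM : M ∈ connRot) (hN : N ∈ connRot) :
    M * N ∈ connRot := by
  obtain ⟨β, rfl, hβ⟩ := hM
  obtain ⟨γ, rfl, hγ⟩ := hN
  exact ⟨β * γ, rfl, by rw [map_mul]; exact mul_mem hβ hγ⟩

theorem one_mem_connRot : 1 ∈ connRot := ⟨1, rfl, by rw [map_one]; exact one_mem _⟩

theorem preconnectedSpace_S3 : PreconnectedSpace S3 := by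
  refine isPreconnected_iff_preconnectedSpace.1 (isPreconnected_sphere ?_ _ _)
  rw [← Module.finrank_eq_rank, finrank_euclideanSpace_fin]
  norm_num

theorem continuous_refl : Continuous refl := by
  unfold refl
  fun_prop

/-- The product depends continuously on `(w, v)` in the connected space `S³ × S³` and equals `1` on
the diagonal. -/
theorem refl_mul_refl_mem_connRot {w v : Fin 4 → ℝ} (hw : w ⬝ᵥ w = 1) (hv : v ⬝ᵥ v = 1) :
    refl w * refl v ∈ connRot := by
  have := preconnectedSpace_S3
  let c (x : S3 × S3) : SO14 := ⟨embSO4 ⟨refl (x.1 : E4).ofLp * refl (x.2 : E4).ofLp,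
    refl_mul_refl_mem (mem_sphere_iff.1 x.1.2) (mem_sphere_iff.1 x.2.2)⟩,
    K_le_SO14 (embSO4_mem_K _)⟩
  have hc : Continuous c := by
    refine Continuous.subtype_mk (Continuous.subtype_mk ?_ _) _
    refine Continuous.matrix_fromBlocks continuous_const continuous_const continuous_const ?_
    refine Continuous.mul (continuous_refl.comp ?_) (continuous_refl.comp ?_)
    · fun_prop
    · fun_prop
  let w' : S3 := ⟨WithLp.toLp 2 w, mem_sphere_iff.2 hw⟩
  let v' : S3 := ⟨WithLp.toLp 2 v, mem_sphere_iff.2 hv⟩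
  have h1 : c (v', v') = 1 := by
    apply Subtype.ext
    apply Subtype.ext
    change Matrix.fromBlocks 1 0 0 (refl v * refl v) = 1
    rw [refl_mul_self hv, Matrix.fromBlocks_one]
  have h2 := (isPreconnected_range hc).subset_connectedComponent (x := 1) ⟨_, h1⟩
  exact ⟨⟨refl w * refl v, refl_mul_refl_mem hw hv⟩, rfl, c (w', v'), h2 ⟨(w', v'), rfl⟩, rfl⟩

theorem reflection_orthogonal_apply {v : E4} {r : ℝ} (hr : 0 < r) {u : Fin 4 → ℝ}
    (hu : u ⬝ᵥ u = 1) (hv : v = r • WithLp.toLp 2 u) (x : E4) :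
    (Submodule.span ℝ {v})ᗮ.reflection x = WithLp.toLp 2 (refl u *ᵥ x.ofLp) := by
  have hn : ‖v‖ = r := by
    have h1 : ‖(WithLp.toLp 2 u : E4)‖ = 1 := mem_sphere_zero_iff_norm.1 (mem_sphere_iff.2 hu)
    rw [hv, norm_smul, h1, mul_one, Real.norm_of_nonneg hr.le]
  have hi : inner ℝ v x = r * (u ⬝ᵥ x.ofLp) := by
    rw [hv, real_inner_smul_left]
    simp [PiLp.inner_apply, dotProduct, mul_comm]
  rw [Submodule.reflection_orthogonal_apply, Submodule.reflection_singleton_apply, hn, hi,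
    refl_mulVec, hv]
  ext i
  simp
  field_simp

/-- The two alternatives stand for an even and an odd number of genuine reflections; each further
one exchanges them. -/
theorem mem_connRot_of_prod_reflection (l : List E4) (β : Matrix (Fin 4) (Fin 4) ℝ)
    (hβ : ∀ x : E4, (l.map fun v => (Submodule.span ℝ {v})ᗮ.reflection).prod x =
      WithLp.toLp 2 (β *ᵥ x.ofLp)) :
    β ∈ connRot ∨ ∀ w : Fin 4 → ℝ, w ⬝ᵥ w = 1 → refl w * β ∈ connRot := by
  induction l generalizing β with
  | nil =>
    have : β = 1 := by
      refine Matrix.ext_of_mulVec_single fun j => ?_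
      have := congrArg WithLp.ofLp (hβ (WithLp.toLp 2 (Pi.single j 1)))
      rw [Matrix.one_mulVec]
      exact this.symm
    exact .inl (this ▸ one_mem_connRot)
  | cons v l ih =>
    simp only [List.map_cons, List.prod_cons, LinearIsometryEquiv.coe_mul,
      Function.comp_apply] at hβ
    -- The list may contain the zero vector, whose associated reflection is the identity.
    by_cases hv : v.ofLp = 0
    · have hv' : v = 0 := by
        ext i
        simp [hv]
      refine ih β fun x => ?_
      rw [← hβ x, hv', Submodule.reflection_orthogonal_apply]
      simp
    · obtain ⟨r, u, hr, hu, hvu⟩ := exists_unit hv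
      have hvr : v = r • (WithLp.toLp 2 u : E4) := by
        ext i
        simp [hvu]
      have hβ' : refl u * (refl u * β) = β := by
        rw [← Matrix.mul_assoc, refl_mul_self hu, Matrix.one_mul]
      rcases ih (refl u * β) fun x => by
        have h := congrArg (Submodule.span ℝ {v})ᗮ.reflection (hβ x)
        rw [Submodule.reflection_reflection, reflection_orthogonal_apply hr hu hvr] at h
        rw [h, ← Matrix.mulVec_mulVec] with h | h
      · refine .inr fun w hw => ?_
        rw [← hβ', ← Matrix.mul_assoc]
        exact mul_mem_connRot (refl_mul_refl_mem_connRot hw hu) h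
      · exact .inl (hβ' ▸ h u hu)

/-- By Cartan–Dieudonné, `β` is a product of reflections. The odd alternative would put a matrix of
determinant `-1` among the rotations. -/
theorem mem_connRot (β : Matrix.specialOrthogonalGroup (Fin 4) ℝ) :
    (β : Matrix (Fin 4) (Fin 4) ℝ) ∈ connRot := by
  have hisom (x : E4) : ‖Matrix.toEuclideanLin (β : Matrix (Fin 4) (Fin 4) ℝ) x‖ = ‖x‖ := by
    rw [← sq_eq_sq₀ (norm_nonneg _) (norm_nonneg _), EuclideanSpace.real_norm_sq_eq,
      EuclideanSpace.real_norm_sq_eq]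
    have h : ((β : Matrix (Fin 4) (Fin 4) ℝ) *ᵥ x.ofLp) ⬝ᵥ
        ((β : Matrix (Fin 4) (Fin 4) ℝ) *ᵥ x.ofLp) = x.ofLp ⬝ᵥ x.ofLp := by
      rw [Matrix.dotProduct_mulVec, ← Matrix.mulVec_transpose, Matrix.mulVec_mulVec,
        transpose_mul_self, Matrix.one_mulVec]
    simpa [dotProduct, sq] using h
  obtain ⟨l, -, hl⟩ := LinearIsometryEquiv.reflections_generate_dim
    (LinearIsometry.toLinearIsometryEquiv
      ⟨Matrix.toEuclideanLin (β : Matrix (Fin 4) (Fin 4) ℝ), hisom⟩ rfl)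
  rcases mem_connRot_of_prod_reflection l β fun x => by rw [← hl]; rfl with h | h
  · exact h
  · obtain ⟨γ, hγ, -⟩ := h (Pi.single 0 1) single_dotProduct_self
    have := congrArg Matrix.det hγ
    rw [Matrix.det_mul, det_refl single_dotProduct_self,
      (Matrix.mem_specialOrthogonalGroup_iff.1 γ.2).2,
      (Matrix.mem_specialOrthogonalGroup_iff.1 β.2).2] at this
    norm_num at this

/-! ### Assembly of the proposition. -/

theorem K_le_SO14Conn : K ≤ SO14Conn := by
  rintro _ ⟨β, rfl⟩
  obtain ⟨γ, hγ, h⟩ := mem_connRot β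
  rwa [← Subtype.ext hγ]

theorem SO14Conn_le_SO14 : SO14Conn ≤ SO14 := Subgroup.map_subtype_le _

/-- Reduces all flag data to one unit vector `u`; conjugacy of parabolic subgroups then follows from
a rotation between two such vectors. -/
theorem IsFlagData.exists_eq {G : Subgroup SL5} (hG : G ≤ SO14) {a : Submodule ℝ Mat} {H : a}
    {Θ : Set (Module.Dual ℝ a)} (h : IsFlagData a H Θ) :
    ∃ (r : ℝ) (u : Fin 4 → ℝ), 0 < r ∧ u ⬝ᵥ u = 1 ∧ (H : Mat) = r • blk u 0 ∧
      ∀ g, g ∈ parabolicSubgroup G a H Θ ↔ g ∈ G ∧ act g u = u := by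
  obtain ⟨r, u, hr, hu, hH, rfl⟩ := h.regular.exists_eq h.maxAbelian
  obtain rfl : H = r • gen u := Subtype.ext hH
  obtain rfl := (ssubset_simpleRoots_iff hu hr Θ).1 h.ssubset
  exact ⟨r, u, hr, hu, hH, fun g => mem_parabolicSubgroup hG hu hr⟩

end LorentzFlag

end

theorem mainTheorem7 (G : Subgroup LorentzFlag.SL5)
    (hG : G = LorentzFlag.SO14 ∨ G = LorentzFlag.SO14Conn) :
    -- `so(1,4)` has real rank one
    (∀ a : Submodule ℝ LorentzFlag.Mat,
      LorentzFlag.IsMaxAbelian a → Module.finrank ℝ a = 1) ∧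
    -- for each Weyl chamber, the only flag manifold is the maximal one, `Θ = ∅`
    (∀ (a : Submodule ℝ LorentzFlag.Mat) (H : a),
      LorentzFlag.IsMaxAbelian a → LorentzFlag.IsRegular a H →
      ∀ Θ : Set (Module.Dual ℝ a), Θ ⊂ LorentzFlag.simpleRoots a H ↔ Θ = ∅) ∧
    -- up to conjugation, it does not depend on the choices
    (∀ (a : Submodule ℝ LorentzFlag.Mat) (H : a) (Θ : Set (Module.Dual ℝ a))
      (a' : Submodule ℝ LorentzFlag.Mat) (H' : a') (Θ' : Set (Module.Dual ℝ a')),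
      LorentzFlag.IsFlagData a H Θ → LorentzFlag.IsFlagData a' H' Θ' →
      ∃ g ∈ G, LorentzFlag.parabolicSubgroup G a' H' Θ' =
        (LorentzFlag.parabolicSubgroup G a H Θ).map (MulAut.conj g).toMonoidHom) ∧
    -- `H = [0 e₁; e₁ᵗ 0]` spans a maximal abelian `𝔞`, is regular, and `K_H = SO(3)`
    LorentzFlag.IsMaxAbelian (Submodule.span ℝ {LorentzFlag.H0}) ∧
    LorentzFlag.IsRegular (Submodule.span ℝ {LorentzFlag.H0})
      ⟨LorentzFlag.H0, Submodule.mem_span_singleton_self LorentzFlag.H0⟩ ∧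
    LorentzFlag.KH LorentzFlag.H0 = LorentzFlag.SO3 ∧
    -- each flag manifold is `G / P = K / K_H = SO(4) / SO(3) = S³`
    (∀ (a : Submodule ℝ LorentzFlag.Mat) (H : a) (Θ : Set (Module.Dual ℝ a)),
      LorentzFlag.IsFlagData a H Θ →
      LorentzFlag.K ≤ G ∧
      LorentzFlag.K ⊓ LorentzFlag.parabolicSubgroup G a H Θ = LorentzFlag.KH (H : LorentzFlag.Mat) ∧
      (∃ k ∈ LorentzFlag.K, LorentzFlag.KH (H : LorentzFlag.Mat) =
        LorentzFlag.SO3.map (MulAut.conj k).toMonoidHom) ∧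
      ∃ (φ : LorentzFlag.FlagManifold G a H Θ ≃ₜ LorentzFlag.S3)
        (ψ : LorentzFlag.Homog LorentzFlag.K (LorentzFlag.KH (H : LorentzFlag.Mat)) ≃ₜ
          LorentzFlag.S3),
        LorentzFlag.IsDiffeoSphere φ ∧ LorentzFlag.IsDiffeoSphere ψ ∧
        -- the diffeomorphism `φ⁻¹ ∘ ψ` is the canonical map `k K_H ↦ k P`
        (∀ (k : LorentzFlag.K) (g : G), (k : LorentzFlag.SL5) = (g : LorentzFlag.SL5) →
          ψ (QuotientGroup.mk k) = φ (QuotientGroup.mk g)) ∧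
        -- `K = SO(4)` acts on `S³` by rotations
        (∀ (β : Matrix.specialOrthogonalGroup (Fin 4) ℝ) (g : G),
          LorentzFlag.embSO4 β = (g : LorentzFlag.SL5) →
          ∀ x : LorentzFlag.FlagManifold G a H Θ,
            (φ (g • x) : LorentzFlag.E4) =
              WithLp.toLp 2 ((β : Matrix (Fin 4) (Fin 4) ℝ) *ᵥ
                WithLp.ofLp (φ x : LorentzFlag.E4)))) := by
  open LorentzFlag in
  have hK : K ≤ G := by
    rcases hG with rfl | rfl
    · exact K_le_SO14
    · exact K_le_SO14Conn
  have hGle : G ≤ SO14 := by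
    rcases hG with rfl | rfl
    · exact le_rfl
    · exact SO14Conn_le_SO14
  refine ⟨fun a ha => ha.finrank_eq_one, ?_, ?_, ?_, ?_, KH_H0, ?_⟩
  · intro a H ha hH Θ
    obtain ⟨r, u, hr, hu, hH', rfl⟩ := hH.exists_eq ha
    obtain rfl : H = r • gen u := Subtype.ext hH'
    exact ssubset_simpleRoots_iff hu hr Θ
  · intro a H Θ a' H' Θ' h h'
    obtain ⟨r, u, -, hu, -, hP⟩ := h.exists_eq hGle
    obtain ⟨r', u', -, hu', -, hP'⟩ := h'.exists_eq hGle
    exact ⟨embSO4 (rot hu hu'), hK (embSO4_mem_K _),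
      eq_map_conj hGle hu hP hP' (hK (embSO4_mem_K _)) (act_rot hu hu')⟩
  · rw [H0_eq_blk]
    exact isMaxAbelian_span single_dotProduct_self
  · exact isRegular_H0
  · intro a H Θ h
    obtain ⟨r, u, hr, hu, hH, hP⟩ := h.exists_eq hGle
    rw [hH]
    have hKH (g : SL5) : g ∈ KH (r • blk u 0) ↔ g ∈ K ∧ act g u = u := mem_KH hr.ne'
    refine ⟨hK, ?_, ?_, ?_⟩
    · ext g
      rw [Subgroup.mem_inf, hP, hKH]
      exact ⟨fun h => ⟨h.1, h.2.2⟩, fun h => ⟨h.1, hK h.1, h.2⟩⟩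
    · exact ⟨embSO4 (rot single_dotProduct_self hu), embSO4_mem_K _,
        eq_map_conj K_le_SO14 single_dotProduct_self (fun g => mem_SO3) hKH (embSO4_mem_K _)
          (act_rot _ hu)⟩
    · obtain ⟨φ, hφ, hφ'⟩ := exists_isDiffeoSphere hK hGle hu hP
      obtain ⟨ψ, hψ, hψ'⟩ := exists_isDiffeoSphere le_rfl K_le_SO14 hu hKH
      refine ⟨φ, ψ, hφ, hψ, ?_, ?_⟩
      · intro k g hkg
        apply Subtype.ext
        rw [hφ', hψ', hkg]
      · intro β g hβ x
        induction x using QuotientGroup.induction_on with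
        | H h =>
          rw [hφ', ← act_embSO4, hβ, ← act_mul (hGle g.2) (hGle h.2) hu]
          exact hφ' (g * h)
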